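/- **Conventions.** Let $S$ be a scheme and $d\ge 0$ an integer. $\mathrm{CAlg}(S)$ is the category of pairs $(A,x)$ with $A$ a commutative ring and $x:\mathrm{Spec}\,A\to S$; a morphism $(A,x)\to(B,y)$ is a ring homomorphism $A\to B$ carrying $x$ to $y$. A quasi-coherent sheaf $\mathcal F$ on $S$ is a functor assigning to each $(A,x)$ an $A$-module $\mathcal F(A,x)$ such that every $(A,x)\to(B,y)$ induces an isomorphism $\mathcal F(A,x)\otimes_A B\cong\mathcal F(B,y)$. $\mathrm{Alg}_S$ is the category of quasi-coherent sheaves of associative unital (not necessarily commutative) $\mathcal O_S$-algebras. A polynomial law $\psi:\mathcal F\leadsto\mathcal G$ is a natural transformation of the underlying set-valued functors; it is homogeneous of degree $n$ if $\psi(az)=a^n\psi(z)$. Let $\mathrm T(\mathcal M)$ denote the tensor algebra, $\Gamma(\mathcal M)=\bigoplus_n\Gamma^n(\mathcal M)$ the divided power algebra (viewed as a quasi-coherent sheaf of modules), and $*$ the coproduct in $\mathrm{Alg}_S$. Every polynomial law $\psi:\mathcal F\leadsto\mathcal G$ is uniquely a locally finite sum $\sum_n\psi_n$ of homogeneous laws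 $\psi_n$ of degree $n$, and the linear morphism $\Gamma(\mathcal F)\to\mathcal G$ induced by $\psi$ is the unique one with $z^{[n]}\mapsto\psi_n(z)$ for all $n$ and all sections $z$. **The category $\mathcal P\mathrm{oly}^d_{\mathrm{bi}}(S)$.** Objects are tuples $\Psi=(\mathcal F,\mathcal A_{-2},\mathcal G,\mathcal A_0,\dots,\mathcal A_d,\psi_{-2},\psi_{-1},\psi_0,\dots,\psi_d)$ with $\mathcal F,\mathcal G$ quasi-coherent sheaves, $\mathcal A_i\in\mathrm{Alg}_S$, $\psi_{-2}:\mathcal G\otimes\mathcal G\to\mathcal A_{-2}$ linear, and polynomial laws $\psi_{-1}:\mathcal F\leadsto\mathcal G$ and $\psi_i:\mathcal F\leadsto\mathcal A_i$ $(0\le i\le d)$. A morphism $\Psi\to\Psi'$ is a polynomial law $u:\mathcal F\leadsto\mathcal F'$, a linear morphism $u_{-1}:\mathcal G\to\mathcal G'$ and algebra morphisms $u_i:\mathcal A_i\to\mathcal A_i'$ $(i=-2,0,\dots,d)$ with $u_{-2}\psi_{-2}=\psi'_{-2}(u_{-1}\otimes u_{-1})$ and $u_i\psi_i=\psi_i'u$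 for $-1\le i\le d$. **The functor $F^d_S:\mathrm{Alg}_S\to\mathcal P\mathrm{oly}^d_{\mathrm{bi}}(S)$** sends $\mathcal A$ to $(\mathcal A^{\oplus(d+1)},\mathcal A,\dots,\mathcal A,\mathrm{pr}_{-2},\dots,\mathrm{pr}_d)$, where $\mathrm{pr}_{-2}(x\otimes y)=xy-yx$, $\mathrm{pr}_i(a_{-1},\dots,a_{d-1})=a_i$ for $-1\le i\le d-1$, and $\mathrm{pr}_d(a_{-1},\dots,a_{d-1})=a_0a_{-1}^d+a_1a_{-1}^{d-1}+\dots+a_{d-1}a_{-1}$. **Theorem.** The functor $F^d_S$ has a left adjoint. Moreover, if $\mathrm{Cl}$ is a left adjoint of $F^d_S$ and $\Psi$ is an object of $\mathcal P\mathrm{oly}^d_{\mathrm{bi}}(S)$ as above, then $\mathrm{Cl}(\Psi)$ is the colimit in $\mathrm{Alg}_S$ of the diagram $$\mathcal A_{-2}\longleftarrow\mathrm T(\mathcal G\otimes\mathcal G)\longrightarrow\mathcal A_0*\cdots*\mathcal A_{d-1}*\mathrm T(\mathcal G)\longleftarrow\mathrm T(\Gamma(\mathcal F))\longrightarrow\mathcal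 A_d,$$ where the arrows are the algebra morphisms induced, from left to right, by $\psi_{-2}$; by the linear morphism $\mathcal G\otimes\mathcal G\to\mathrm T(\mathcal G)$, $m\otimes n\mapsto m\otimes n-n\otimes m$; by the linear morphism on $\Gamma(\mathcal F)$ induced by the polynomial law $$\psi_0\psi_{-1}^d+\psi_1\psi_{-1}^{d-1}+\dots+\psi_{d-1}\psi_{-1}:\mathcal F\leadsto\mathcal A_0*\cdots*\mathcal A_{d-1}*\mathrm T(\mathcal G);$$ and by the linear morphism on $\Gamma(\mathcal F)$ induced by $\psi_d$. The colimit cocone consists of the components $\mathcal A_{-2}\to\mathrm{Cl}(\Psi)$ and $\mathcal A_d\to\mathrm{Cl}(\Psi)$ of the unit $\Psi\to F^d_S(\mathrm{Cl}(\Psi))$ and of the morphism $\mathcal A_0*\cdots*\mathcal A_{d-1}*\mathrm T(\mathcal G)\to\mathrm{Cl}(\Psi)$ determined by its components $\mathcal A_i\to\mathrm{Cl}(\Psi)$ $(0\le i\le d-1)$ and $\mathcal G\to\mathrm{Cl}(\Psi)$. -/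

import Mathlib

open CategoryTheory AlgebraicGeometry TensorProduct
universe u
namespace PolyLaw

noncomputable section BaseChange

/-- For a ring homomorphism `f : A → B` and an `f`-semilinear map `φ : M → N`: the induced `B`-linear
map `B ⊗[A] M → N` is an isomorphism. -/
def IsBaseChangeAlong {A B : Type u} [CommRing A] [CommRing B] (f : A →+* B)
    {M N : Type u} [AddCommGroup M] [AddCommGroup N] [Module A M] [Module B N]
    (φ : M →ₛₗ[f] N) : Prop :=
  letI : Algebra A B := f.toAlgebra
  letI : Module A N := Module.compHom N f
  haveI : IsScalarTower A B N := ⟨fun a b n => mul_smul (f a) b n⟩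
  IsBaseChange B ({ toFun := φ, map_add' := φ.map_add, map_smul' := φ.map_smulₛₗ } : M →ₗ[A] N)

variable {A B : Type u} [CommRing A] [CommRing B] [Algebra A B]

theorem exists_algHom_tensor {R C : Type u} [Semiring R] [Algebra A R] [Semiring C] [Algebra B C]
    [Algebra A C] [IsScalarTower A B C] (g : R →ₐ[A] C) :
    ∃ χ : B ⊗[A] R →ₐ[B] C, ∀ b r, χ (b ⊗ₜ r) = b • g r := by
  refine ⟨Algebra.TensorProduct.lift (Algebra.ofId B C) g fun b r => ?_, fun b r => ?_⟩
  · rw [Algebra.ofId_apply]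
    exact Algebra.commute_algebraMap_left b _
  · rw [Algebra.TensorProduct.lift_tmul, Algebra.ofId_apply, Algebra.smul_def]

theorem isBaseChange_of_algHom {R R' : Type u} [Semiring R] [Algebra A R] [Semiring R'] [Algebra B R']
    [Algebra A R'] [IsScalarTower A B R'] (φ : R →ₐ[A] R') (ψ : R' →ₐ[B] B ⊗[A] R)
    (h : ∀ r, ψ (φ r) = 1 ⊗ₜ r)
    (h' : ∀ χ : R' →ₐ[B] R', (∀ r, χ (φ r) = φ r) → χ = AlgHom.id B R') :
    IsBaseChange B φ.toLinearMap := by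
  obtain ⟨χ, hχ'⟩ := exists_algHom_tensor (B := B) φ
  have hχ : ∀ r, χ (1 ⊗ₜ r) = φ r := fun r => by rw [hχ', one_smul]
  have h₁ : χ.comp ψ = AlgHom.id B R' := h' _ fun r => by simp [h, hχ]
  have h₂ : ψ.comp χ = AlgHom.id B (B ⊗[A] R) := by
    ext r
    simp [h, hχ]
  exact IsBaseChange.of_equiv (AlgEquiv.ofAlgHom χ ψ h₁ h₂).toLinearEquiv hχ

theorem isBaseChange_tensor {M M' N N' : Type u} [AddCommGroup M] [AddCommGroup M']
    [AddCommGroup N] [AddCommGroup N'] [Module A M] [Module A M'] [Module B N] [Module B N']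
    [Module A N] [Module A N'] [IsScalarTower A B N] [IsScalarTower A B N']
    {f : M →ₗ[A] N} {g : M' →ₗ[A] N'} (hf : IsBaseChange B f) (hg : IsBaseChange B g)
    (k : M ⊗[A] M' →ₗ[A] N ⊗[B] N') (hk : ∀ m m', k (m ⊗ₜ m') = f m ⊗ₜ g m') :
    IsBaseChange B k := by
  refine IsBaseChange.of_equiv ((AlgebraTensorModule.distribBaseChange A B M M').trans
    (TensorProduct.congr hf.equiv hg.equiv)) fun x => ?_
  induction x with
  | zero => simp
  | tmul m m' =>
    rw [hk, LinearEquiv.trans_apply, AlgebraTensorModule.distribBaseChange_tmul,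
      TensorProduct.congr_tmul, hf.equiv_tmul, hg.equiv_tmul, one_smul, one_smul]
  | add x y hx hy => rw [TensorProduct.tmul_add, map_add, hx, hy, map_add]

theorem isBaseChange_pow {M N P : Type u} [AddCommGroup M] [AddCommGroup N] [AddCommGroup P]
    [Module A M] [Module B N] [Module A N] [IsScalarTower A B N] [Module B P] [Module A P]
    [IsScalarTower A B P] {f : M →ₗ[A] N} (hf : IsBaseChange B f) (n : ℕ)
    (e : P ≃ₗ[B] (Fin n → N)) (k : (Fin n → M) →ₗ[A] P) (hk : ∀ m i, e (k m) i = f (m i)) :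
    IsBaseChange B k := by
  refine (IsBaseChange.iff_of_equiv_comm (LinearEquiv.refl A (Fin n → M)) e.symm ?_).mp
    (IsBaseChange.finitePow (Fin n) hf)
  refine LinearMap.ext fun m => e.injective ?_
  exact (funext fun i => hk m i).trans (e.apply_symm_apply _).symm

theorem exists_algHom_of_isBaseChange {R R' C : Type u} [Semiring R] [Algebra A R] [Semiring R']
    [Algebra B R'] [Algebra A R'] [IsScalarTower A B R'] [Semiring C] [Algebra B C] [Algebra A C]
    [IsScalarTower A B C] {f : R →ₐ[A] R'} (hf : IsBaseChange B f.toLinearMap)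
    (g : R →ₐ[A] C) : ∃ g' : R' →ₐ[B] C, ∀ r, g' (f r) = g r := by
  obtain ⟨χ, hχ'⟩ := exists_algHom_tensor (B := B) f
  obtain ⟨γ, hγ⟩ := exists_algHom_tensor (B := B) g
  have hχ : ∀ x, χ x = hf.equiv x := fun x => by
    induction x with
    | zero => simp
    | tmul b r => rw [hχ', hf.equiv_tmul]; rfl
    | add x y hx hy => rw [map_add, hx, hy, map_add]
  have hb : Function.Bijective χ := by
    have : (χ : B ⊗[A] R → R') = hf.equiv := funext hχ
    rw [this]
    exact hf.equiv.bijective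
  refine ⟨γ.comp (AlgEquiv.ofBijective χ hb).symm, fun r => ?_⟩
  have h1 : (AlgEquiv.ofBijective χ hb).symm (f r) = 1 ⊗ₜ r := by
    rw [AlgEquiv.symm_apply_eq, AlgEquiv.ofBijective_apply, hχ', one_smul]
  change γ ((AlgEquiv.ofBijective χ hb).symm (f r)) = _
  rw [h1, hγ, one_smul]

theorem algHom_ext_of_isBaseChange {R R' C : Type u} [Semiring R] [Algebra A R] [Semiring R']
    [Algebra B R'] [Algebra A R'] [IsScalarTower A B R'] [Semiring C] [Algebra B C]
    {f : R →ₐ[A] R'} (hf : IsBaseChange B f.toLinearMap) {g g' : R' →ₐ[B] C}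
    (h : ∀ r, g (f r) = g' (f r)) : g = g' :=
  AlgHom.toLinearMap_injective (hf.algHom_ext g.toLinearMap g'.toLinearMap h)

theorem isBaseChange_tensorAlgebra {M N : Type u} [AddCommGroup M] [AddCommGroup N] [Module A M]
    [Module B N] [Module A N] [IsScalarTower A B N] {f : M →ₗ[A] N} (hf : IsBaseChange B f)
    {T : Type u} [Semiring T] [Algebra B T] [Algebra A T] [IsScalarTower A B T]
    (e : T ≃ₐ[B] TensorAlgebra B N) (φ : TensorAlgebra A M →ₐ[A] T)
    (hφ : ∀ m, φ (TensorAlgebra.ι A m) = e.symm (TensorAlgebra.ι B (f m))) :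
    IsBaseChange B φ.toLinearMap := by
  let i : M →ₗ[A] B ⊗[A] TensorAlgebra A M :=
    (TensorProduct.mk A B (TensorAlgebra A M) 1).comp (TensorAlgebra.ι A)
  let ψ : TensorAlgebra B N →ₐ[B] B ⊗[A] TensorAlgebra A M := TensorAlgebra.lift B (hf.lift i)
  refine isBaseChange_of_algHom φ (ψ.comp e.toAlgHom) (fun r => ?_) (fun χ hχ => ?_)
  · have : ((ψ.comp e.toAlgHom).restrictScalars A).comp φ =
        Algebra.TensorProduct.includeRight := by
      ext m
      simp [hφ, ψ, hf.lift_eq, i]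
    exact DFunLike.congr_fun this r
  · have : χ.comp e.symm.toAlgHom = e.symm.toAlgHom := by
      refine TensorAlgebra.hom_ext (hf.algHom_ext _ _ fun m => ?_)
      simpa [hφ] using hχ (TensorAlgebra.ι A m)
    ext x
    simpa using DFunLike.congr_fun this (e x)

theorem isBaseChange_freeProduct {I : Type} [DecidableEq I] {R R' : I → Type u}
    [∀ i, Semiring (R i)] [∀ i, Algebra A (R i)] [∀ i, Semiring (R' i)] [∀ i, Algebra B (R' i)]
    [∀ i, Algebra A (R' i)] [∀ i, IsScalarTower A B (R' i)]
    {f : ∀ i, R i →ₐ[A] R' i} (hf : ∀ i, IsBaseChange B (f i).toLinearMap)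
    {P : Type u} [Semiring P] [Algebra B P] [Algebra A P] [IsScalarTower A B P]
    (e : P ≃ₐ[B] LinearAlgebra.FreeProduct B R') (φ : LinearAlgebra.FreeProduct A R →ₐ[A] P)
    (hφ : ∀ i r, φ (LinearAlgebra.FreeProduct.ι A R i r) =
      e.symm (LinearAlgebra.FreeProduct.ι B R' i (f i r))) :
    IsBaseChange B φ.toLinearMap := by
  choose j hj using fun i => exists_algHom_of_isBaseChange (hf i)
    (Algebra.TensorProduct.includeRight.comp (LinearAlgebra.FreeProduct.ι A R i) :
      R i →ₐ[A] B ⊗[A] LinearAlgebra.FreeProduct A R)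
  let ψ : LinearAlgebra.FreeProduct B R' →ₐ[B] B ⊗[A] LinearAlgebra.FreeProduct A R :=
    LinearAlgebra.FreeProduct.lift B R' (fun {i} => j i)
  have hψ : ∀ i x, ψ (LinearAlgebra.FreeProduct.ι B R' i x) = j i x := fun i x =>
    DFunLike.congr_fun (LinearAlgebra.FreeProduct.lift_comp_ι B R' (fun {i} => j i)) x
  have ext : ∀ {C : Type u} [Semiring C] [Algebra B C]
      (g g' : LinearAlgebra.FreeProduct B R' →ₐ[B] C),
      (∀ i x, g (LinearAlgebra.FreeProduct.ι B R' i x) =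
        g' (LinearAlgebra.FreeProduct.ι B R' i x)) → g = g' := fun g g' h =>
    (LinearAlgebra.FreeProduct.lift B R').symm.injective (by
      funext i
      exact AlgHom.ext (h i))
  refine isBaseChange_of_algHom φ (ψ.comp e.toAlgHom) (fun r => ?_) (fun χ hχ => ?_)
  · have : ((ψ.comp e.toAlgHom).restrictScalars A).comp φ =
        Algebra.TensorProduct.includeRight := by
      refine (LinearAlgebra.FreeProduct.lift A R).symm.injective ?_
      funext i
      refine AlgHom.ext fun r => ?_
      change ψ (e (φ (LinearAlgebra.FreeProduct.ι A R i r))) =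
        1 ⊗ₜ (LinearAlgebra.FreeProduct.ι A R i r)
      rw [hφ, AlgEquiv.apply_symm_apply, hψ, hj]
      rfl
    exact DFunLike.congr_fun this r
  · have : χ.comp e.symm.toAlgHom = e.symm.toAlgHom := by
      refine ext _ _ fun i => DFunLike.congr_fun (algHom_ext_of_isBaseChange (hf i)
        (g := (χ.comp e.symm.toAlgHom).comp (LinearAlgebra.FreeProduct.ι B R' i))
        (g' := e.symm.toAlgHom.comp (LinearAlgebra.FreeProduct.ι B R' i)) fun r => ?_)
      have := hχ (LinearAlgebra.FreeProduct.ι A R i r)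
      rw [hφ] at this
      exact this
    refine AlgHom.ext fun x => ?_
    have := DFunLike.congr_fun this (e x)
    simpa using this

/-- Power series `c` with `c 0 = 1` and `c (X + Y) = c X * c Y`. Used only to prove that divided power
algebras commute with base change. -/
def expSeries (C : Type u) [CommSemiring C] : Submonoid (PowerSeries C) where
  carrier := {c | c.coeff 0 = 1 ∧
    ∀ m n, c.coeff m * c.coeff n = (m + n).choose m • c.coeff (m + n)}
  one_mem' := by
    refine ⟨by simp, fun m n => ?_⟩
    rcases m with _ | m <;> rcases n with _ | n <;> simp [PowerSeries.coeff_one]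
  mul_mem' := by
    rintro a b ⟨ha, ha'⟩ ⟨hb, hb'⟩
    refine ⟨by simp_all [PowerSeries.coeff_mul], fun m n => ?_⟩
    simp only [PowerSeries.coeff_mul]
    rw [Finset.sum_mul_sum, Finset.smul_sum]
    have h1 : ∀ p ∈ Finset.HasAntidiagonal.antidiagonal (m + n), (m + n).choose m • (a.coeff p.1 * b.coeff p.2) =
        ∑ i ∈ Finset.HasAntidiagonal.antidiagonal m,
          (p.1.choose i.1 * p.2.choose i.2) • (a.coeff p.1 * b.coeff p.2) := by
      intro p hp
      rw [← Finset.sum_smul, ← Nat.add_choose_eq, Finset.HasAntidiagonal.mem_antidiagonal.mp hp]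
    rw [Finset.sum_congr rfl h1]
    conv_rhs => rw [Finset.sum_comm]
    refine Finset.sum_congr rfl fun i hi => ?_
    have hi' := Finset.HasAntidiagonal.mem_antidiagonal.mp hi
    refine Finset.sum_of_injOn (fun k => (i.1 + k.1, i.2 + k.2)) ?_ ?_ ?_ ?_
    · rintro ⟨k, l⟩ _ ⟨k', l'⟩ _ h
      simpa using h
    · rintro ⟨k, l⟩ hk
      have hk' : k + l = n := by simpa using hk
      simp only [Finset.mem_coe,
        Finset.HasAntidiagonal.mem_antidiagonal]
      omega
    · rintro ⟨p, q⟩ hp hpq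
      have hp' : p + q = m + n := by simpa using hp
      have : p < i.1 ∨ q < i.2 := by
        by_contra! h
        refine hpq ⟨(p - i.1, q - i.2), ?_, ?_⟩
        · simp only [Finset.mem_coe, Finset.HasAntidiagonal.mem_antidiagonal]
          omega
        · ext <;> simp <;> omega
      rcases this with h | h <;> simp [Nat.choose_eq_zero_of_lt h]
    · rintro ⟨k, l⟩ _
      calc a.coeff i.1 * b.coeff i.2 * (a.coeff k * b.coeff l)
          = (a.coeff i.1 * a.coeff k) * (b.coeff i.2 * b.coeff l) := by ring
        _ = _ := by rw [ha', hb', smul_mul_smul_comm]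

/-- The exponential power series, written additively; they form a module over every ring over which
`C` is an algebra, through `(b • c) X = c (b X)`. -/
def ExpMod (C : Type u) [CommSemiring C] : Type u := Additive (expSeries C)

instance (C : Type u) [CommSemiring C] : AddCommMonoid (ExpMod C) :=
  inferInstanceAs (AddCommMonoid (Additive (expSeries C)))

def ExpMod.coeff {C : Type u} [CommSemiring C] (c : ExpMod C) (n : ℕ) : C :=
  PowerSeries.coeff n (Additive.toMul (α := expSeries C) c : PowerSeries C)

@[ext] theorem ExpMod.ext {C : Type u} [CommSemiring C] {c c' : ExpMod C}
    (h : ∀ n, c.coeff n = c'.coeff n) : c = c' :=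
  (Additive.toMul (α := expSeries C)).injective (Subtype.ext (PowerSeries.ext h))

def ExpMod.mk {C : Type u} [CommSemiring C] (c : ℕ → C) (h₀ : c 0 = 1)
    (h : ∀ m n, c m * c n = (m + n).choose m • c (m + n)) : ExpMod C :=
  Additive.ofMul (α := expSeries C) ⟨PowerSeries.mk c, by simpa using h₀, by simpa using h⟩

theorem ExpMod.coeff_mk {C : Type u} [CommSemiring C] (c : ℕ → C) (h₀ : c 0 = 1)
    (h : ∀ m n, c m * c n = (m + n).choose m • c (m + n)) (n : ℕ) :
    (ExpMod.mk c h₀ h).coeff n = c n := PowerSeries.coeff_mk n c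

theorem ExpMod.coeff_zero' {C : Type u} [CommSemiring C] (c : ExpMod C) : c.coeff 0 = 1 :=
  (Additive.toMul (α := expSeries C) c).2.1

theorem ExpMod.coeff_mul_coeff {C : Type u} [CommSemiring C] (c : ExpMod C) (m n : ℕ) :
    c.coeff m * c.coeff n = (m + n).choose m • c.coeff (m + n) :=
  (Additive.toMul (α := expSeries C) c).2.2 m n

theorem ExpMod.coeff_add {C : Type u} [CommSemiring C] (c c' : ExpMod C) (n : ℕ) :
    (c + c').coeff n = ∑ k ∈ Finset.HasAntidiagonal.antidiagonal n, c.coeff k.1 * c'.coeff k.2 :=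
  PowerSeries.coeff_mul _ _ _

theorem ExpMod.coeff_zero {C : Type u} [CommSemiring C] (n : ℕ) :
    (0 : ExpMod C).coeff n = if n = 0 then 1 else 0 :=
  PowerSeries.coeff_one n

instance {C : Type u} [CommSemiring C] [Algebra B C] : SMul B (ExpMod C) where
  smul b c := ExpMod.mk (fun n => b ^ n • c.coeff n) (by simp [c.coeff_zero']) fun m n => by
    rw [smul_mul_smul_comm, c.coeff_mul_coeff, pow_add, smul_comm]

theorem ExpMod.coeff_smul {C : Type u} [CommSemiring C] [Algebra B C] (b : B) (c : ExpMod C) (n : ℕ) :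
    (b • c).coeff n = b ^ n • c.coeff n := ExpMod.coeff_mk _ _ _ n

instance {C : Type u} [CommSemiring C] [Algebra B C] : Module B (ExpMod C) where
  one_smul c := by ext; simp [ExpMod.coeff_smul]
  mul_smul a b c := by ext; simp [ExpMod.coeff_smul, mul_pow, mul_smul]
  smul_zero a := by
    ext n
    rw [ExpMod.coeff_smul, ExpMod.coeff_zero]
    rcases n with _ | n <;> simp
  zero_smul c := by
    ext n
    rw [ExpMod.coeff_smul, ExpMod.coeff_zero]
    rcases n with _ | n <;> simp [c.coeff_zero']
  smul_add b c c' := by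
    ext n
    rw [ExpMod.coeff_smul, ExpMod.coeff_add, ExpMod.coeff_add, Finset.smul_sum]
    refine Finset.sum_congr rfl fun k hk => ?_
    rw [ExpMod.coeff_smul, ExpMod.coeff_smul, smul_mul_smul_comm, ← pow_add,
      Finset.HasAntidiagonal.mem_antidiagonal.mp hk]
  add_smul b b' c := by
    ext n
    rw [ExpMod.coeff_smul, ExpMod.coeff_add, (Commute.all b b').add_pow', Finset.sum_smul]
    refine Finset.sum_congr rfl fun k hk => ?_
    rw [ExpMod.coeff_smul, ExpMod.coeff_smul, smul_mul_smul_comm, c.coeff_mul_coeff,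
      Finset.HasAntidiagonal.mem_antidiagonal.mp hk, smul_assoc, smul_comm]

theorem isBaseChange_dividedPowerAlgebra {M N : Type u} [AddCommGroup M] [AddCommGroup N]
    [Module A M] [Module B N] [Module A N] [IsScalarTower A B N] {f : M →ₗ[A] N}
    (hf : IsBaseChange B f) {T : Type u} [CommSemiring T] [Algebra B T] [Algebra A T]
    [IsScalarTower A B T] (e : T ≃ₐ[B] DividedPowerAlgebra B N)
    (φ : DividedPowerAlgebra A M →ₐ[A] T)
    (hφ : ∀ n m, φ (DividedPowerAlgebra.dp A n m) = e.symm (DividedPowerAlgebra.dp B n (f m))) :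
    IsBaseChange B φ.toLinearMap := by
  let i : DividedPowerAlgebra A M →ₐ[A] B ⊗[A] DividedPowerAlgebra A M := Algebra.TensorProduct.includeRight
  let E : M →ₗ[A] ExpMod (B ⊗[A] DividedPowerAlgebra A M) :=
    { toFun := fun m => ExpMod.mk (fun n => i (DividedPowerAlgebra.dp A n m))
        (by rw [DividedPowerAlgebra.dp_zero, map_one])
        (fun n k => by rw [← map_mul, DividedPowerAlgebra.dp_mul, map_nsmul])
      map_add' := fun m m' => by
        ext n
        rw [ExpMod.coeff_add, ExpMod.coeff_mk, DividedPowerAlgebra.dp_add, map_sum]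
        simp only [ExpMod.coeff_mk, map_mul]
      map_smul' := fun a m => by
        ext n
        rw [RingHom.id_apply, ExpMod.coeff_smul, ExpMod.coeff_mk, ExpMod.coeff_mk,
          DividedPowerAlgebra.dp_smul, map_smul] }
  have : IsScalarTower A B (ExpMod (B ⊗[A] DividedPowerAlgebra A M)) := ⟨fun a b c => by
    ext n
    simp only [ExpMod.coeff_smul, smul_pow, smul_assoc]⟩
  let E' : N →ₗ[B] ExpMod (B ⊗[A] DividedPowerAlgebra A M) := hf.lift E
  let ψ : DividedPowerAlgebra B N →ₐ[B] B ⊗[A] DividedPowerAlgebra A M :=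
    DividedPowerAlgebra.lift' (f := fun p => (E' p.2).coeff p.1)
      (fun m => (E' m).coeff_zero')
      (fun n r m => by rw [map_smul, ExpMod.coeff_smul])
      (fun n p m => (E' m).coeff_mul_coeff n p)
      (fun n x y => by rw [map_add, ExpMod.coeff_add])
  have hψ : ∀ n m, ψ (DividedPowerAlgebra.dp B n (f m)) = i (DividedPowerAlgebra.dp A n m) := by
    intro n m
    rw [DividedPowerAlgebra.lift'_apply_dp]
    change (hf.lift E (f m)).coeff n = _
    rw [hf.lift_eq]
    exact PowerSeries.coeff_mk n fun k => i (DividedPowerAlgebra.dp A k m)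
  refine isBaseChange_of_algHom φ (ψ.comp e.toAlgHom) (fun r => ?_) (fun χ hχ => ?_)
  · induction r using DividedPowerAlgebra.induction_on with
    | C a => rw [AlgHom.commutes, IsScalarTower.algebraMap_apply A B T, AlgHom.commutes,
        ← IsScalarTower.algebraMap_apply, ← i.commutes]; rfl
    | add x y hx hy => rw [map_add, map_add, hx, hy, TensorProduct.tmul_add]
    | dp x n m hx =>
      rw [map_mul, map_mul, hx, hφ]
      have : (ψ.comp e.toAlgHom) (e.symm (DividedPowerAlgebra.dp B n (f m))) =
          i (DividedPowerAlgebra.dp A n m) := by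
        rw [← hψ]
        exact congrArg ψ (e.apply_symm_apply _)
      rw [this]
      exact (map_mul i x (DividedPowerAlgebra.dp A n m)).symm
  · have : χ.comp e.symm.toAlgHom = e.symm.toAlgHom := by
      refine DividedPowerAlgebra.algHom_ext fun n x => ?_
      have key : ∀ ρ : DividedPowerAlgebra B N →ₐ[B] T, ∃ L : N →ₗ[B] ExpMod T,
          ∀ n x, (L x).coeff n = ρ (DividedPowerAlgebra.dp B n x) := fun ρ =>
        ⟨{ toFun := fun m => ExpMod.mk (fun n => ρ (DividedPowerAlgebra.dp B n m))
            (by rw [DividedPowerAlgebra.dp_zero, map_one])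
            (fun n k => by rw [← map_mul, DividedPowerAlgebra.dp_mul, map_nsmul])
           map_add' := fun m m' => by
            ext n
            rw [ExpMod.coeff_add, ExpMod.coeff_mk, DividedPowerAlgebra.dp_add, map_sum]
            simp only [ExpMod.coeff_mk, map_mul]
           map_smul' := fun a m => by
            ext n
            rw [RingHom.id_apply, ExpMod.coeff_smul, ExpMod.coeff_mk, ExpMod.coeff_mk,
              DividedPowerAlgebra.dp_smul, map_smul] },
          fun n x => PowerSeries.coeff_mk n fun k => ρ (DividedPowerAlgebra.dp B k x)⟩
      obtain ⟨L, hL⟩ := key (χ.comp e.symm.toAlgHom)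
      obtain ⟨L', hL'⟩ := key e.symm.toAlgHom
      have : L = L' := hf.algHom_ext _ _ fun m => by
        ext n
        rw [hL, hL']
        have := hχ (DividedPowerAlgebra.dp A n m)
        rw [hφ] at this
        exact this
      rw [← hL, ← hL', this]
    refine AlgHom.ext fun x => ?_
    have := DFunLike.congr_fun this (e x)
    simpa using this

end BaseChange

noncomputable section Sheaves

/-- An affine point of `S`: a pair `(A, x)` of a commutative ring `A` and `x : Spec A ⟶ S`. -/
structure AffinePoint (S : Scheme.{u}) where
  ring : CommRingCat.{u}
  pt : Spec ring ⟶ S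

namespace AffinePoint

variable {S : Scheme.{u}}

/-- A morphism `(A, x) ⟶ (B, y)` is a ring homomorphism `A → B` that carries `x` to `y`. -/
structure Hom (X Y : AffinePoint S) where
  hom : X.ring ⟶ Y.ring
  w : Spec.map hom ≫ X.pt = Y.pt

instance : Category (AffinePoint S) where
  Hom := Hom
  id X := ⟨𝟙 X.ring, by simp⟩
  comp f g := ⟨f.hom ≫ g.hom, by rw [Spec.map_comp, Category.assoc, f.w, g.w]⟩

def ringHom {X Y : AffinePoint S} (f : X ⟶ Y) : X.ring →+* Y.ring := f.hom.hom

theorem ringHom_id (X : AffinePoint S) (a : X.ring) : ringHom (𝟙 X) a = a := rfl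

theorem ringHom_comp {X Y Z : AffinePoint S} (f : X ⟶ Y) (g : Y ⟶ Z) (a : X.ring) :
    ringHom (f ≫ g) a = ringHom g (ringHom f a) := rfl

end AffinePoint

open AffinePoint

/-- A quasi-coherent sheaf on `S`, in the language of functors of points: an `A`-module `M(A, x)` for
every affine point `(A, x)`, functorially in `(A, x)`, such that every morphism `(A, x) ⟶ (B, y)`
induces an isomorphism `B ⊗[A] M(A, x) ≅ M(B, y)`. -/
structure QCoh (S : Scheme.{u}) where
  obj : AffinePoint S → Type u
  [addCommGroup : ∀ X, AddCommGroup (obj X)]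
  [module : ∀ X, Module X.ring (obj X)]
  map : ∀ {X Y : AffinePoint S} (f : X ⟶ Y), obj X →ₛₗ[ringHom f] obj Y
  map_id : ∀ (X : AffinePoint S) (m : obj X), map (𝟙 X) m = m
  map_comp : ∀ {X Y Z : AffinePoint S} (f : X ⟶ Y) (g : Y ⟶ Z) (m : obj X),
    map (f ≫ g) m = map g (map f m)
  isBaseChange : ∀ {X Y : AffinePoint S} (f : X ⟶ Y), IsBaseChangeAlong (ringHom f) (map f)

attribute [instance] QCoh.addCommGroup QCoh.module

/-- A linear morphism of quasi-coherent sheaves. -/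
@[ext]
structure QCoh.Hom {S : Scheme.{u}} (M N : QCoh S) where
  app : ∀ X, M.obj X →ₗ[X.ring] N.obj X
  naturality : ∀ {X Y : AffinePoint S} (f : X ⟶ Y) (m : M.obj X),
    app Y (M.map f m) = N.map f (app X m)

instance (S : Scheme.{u}) : Category (QCoh S) where
  Hom := QCoh.Hom
  id M := { app := fun _ => LinearMap.id, naturality := fun _ _ => rfl }
  comp f g :=
    { app := fun X => (g.app X).comp (f.app X)
      naturality := fun h m => by
        rw [LinearMap.comp_apply, f.naturality, g.naturality, LinearMap.comp_apply] }

/-- A ring homomorphism over `f`, as an `f`-semilinear map. -/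
def semilinearOfRingHom {A B : Type u} [CommRing A] [CommRing B] (f : A →+* B) {R R' : Type u}
    [Ring R] [Ring R'] [Algebra A R] [Algebra B R'] (φ : R →+* R')
    (h : ∀ a, φ (algebraMap A R a) = algebraMap B R' (f a)) : R →ₛₗ[f] R' where
  toFun := φ
  map_add' := map_add φ
  map_smul' a r := by rw [Algebra.smul_def, map_mul, h, Algebra.smul_def]

/-- A quasi-coherent sheaf of (associative unital, not necessarily commutative) algebras on `S`. -/
structure QCohAlg (S : Scheme.{u}) where
  obj : AffinePoint S → Type u
  [ring : ∀ X, Ring (obj X)]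
  [algebra : ∀ X, Algebra X.ring (obj X)]
  map : ∀ {X Y : AffinePoint S} (_ : X ⟶ Y), obj X →+* obj Y
  map_algebraMap : ∀ {X Y : AffinePoint S} (f : X ⟶ Y) (a : X.ring),
    map f (algebraMap X.ring (obj X) a) = algebraMap Y.ring (obj Y) (ringHom f a)
  map_id : ∀ (X : AffinePoint S) (m : obj X), map (𝟙 X) m = m
  map_comp : ∀ {X Y Z : AffinePoint S} (f : X ⟶ Y) (g : Y ⟶ Z) (m : obj X),
    map (f ≫ g) m = map g (map f m)
  isBaseChange : ∀ {X Y : AffinePoint S} (f : X ⟶ Y),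
    IsBaseChangeAlong (ringHom f) (semilinearOfRingHom (ringHom f) (map f) (map_algebraMap f))

attribute [instance] QCohAlg.ring QCohAlg.algebra

/-- A morphism of sheaves of algebras. -/
@[ext]
structure QCohAlg.Hom {S : Scheme.{u}} (R R' : QCohAlg S) where
  app : ∀ X, R.obj X →ₐ[X.ring] R'.obj X
  naturality : ∀ {X Y : AffinePoint S} (f : X ⟶ Y) (r : R.obj X),
    app Y (R.map f r) = R'.map f (app X r)

instance (S : Scheme.{u}) : Category (QCohAlg S) where
  Hom := QCohAlg.Hom
  id R := { app := fun X => AlgHom.id X.ring (R.obj X), naturality := fun _ _ => rfl }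
  comp f g :=
    { app := fun X => (g.app X).comp (f.app X)
      naturality := fun h r => by
        rw [AlgHom.comp_apply, f.naturality, g.naturality, AlgHom.comp_apply] }

variable {S : Scheme.{u}}

/-- The underlying quasi-coherent sheaf of modules of a quasi-coherent sheaf of algebras. -/
abbrev QCohAlg.toQCoh (R : QCohAlg S) : QCoh S where
  obj := R.obj
  map := fun f => semilinearOfRingHom (ringHom f) (R.map f) (R.map_algebraMap f)
  map_id := R.map_id
  map_comp := R.map_comp
  isBaseChange := R.isBaseChange

/-- The linear morphism underlying a morphism of algebras. -/
def QCohAlg.toHom {R R' : QCohAlg S} (φ : R ⟶ R') : R.toQCoh ⟶ R'.toQCoh where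
  app X := (φ.app X).toLinearMap
  naturality := φ.naturality

/-- The tensor product of two quasi-coherent sheaves. -/
def QCoh.tensor (M N : QCoh S) : QCoh S where
  obj X := M.obj X ⊗[X.ring] N.obj X
  map f := TensorProduct.map (M.map f) (N.map f)
  map_id X m := by
    induction m with
    | zero => rw [map_zero]
    | tmul m n => rw [TensorProduct.map_tmul, M.map_id, N.map_id]
    | add x y hx hy => rw [map_add, hx, hy]
  map_comp f g m := by
    induction m with
    | zero => rw [map_zero, map_zero, map_zero]
    | tmul m n => simp only [TensorProduct.map_tmul, M.map_comp, N.map_comp]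
    | add x y hx hy => rw [map_add, hx, hy, map_add, map_add]
  isBaseChange {X Y} f := by
    let _ := (ringHom f).toAlgebra
    let _ : Module X.ring (M.obj Y) := Module.compHom _ (ringHom f)
    let _ : Module X.ring (N.obj Y) := Module.compHom _ (ringHom f)
    let _ : Module X.ring (M.obj Y ⊗[Y.ring] N.obj Y) := Module.compHom _ (ringHom f)
    have : IsScalarTower X.ring Y.ring (M.obj Y) := ⟨fun a b n => mul_smul (ringHom f a) b n⟩
    have : IsScalarTower X.ring Y.ring (N.obj Y) := ⟨fun a b n => mul_smul (ringHom f a) b n⟩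
    exact isBaseChange_tensor (M.isBaseChange f) (N.isBaseChange f) _ fun m m' => rfl

/-- The direct sum of `n` copies of a quasi-coherent sheaf. -/
def QCoh.pow (M : QCoh S) (n : ℕ) : QCoh S where
  obj X := Fin n → M.obj X
  map {X Y} f :=
    { toFun := fun m i => M.map f (m i)
      map_add' := fun m m' => by ext i; simp
      map_smul' := fun a m => by ext i; simp [map_smulₛₗ] }
  map_id X m := funext fun i => M.map_id X (m i)
  map_comp f g m := funext fun i => M.map_comp f g (m i)
  isBaseChange {X Y} f := by
    let _ := (ringHom f).toAlgebra
    let _ : Module X.ring (M.obj Y) := Module.compHom _ (ringHom f)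
    have : IsScalarTower X.ring Y.ring (M.obj Y) := ⟨fun a b n => mul_smul (ringHom f a) b n⟩
    let _ : Module X.ring (Fin n → M.obj Y) := Module.compHom _ (ringHom f)
    have : IsScalarTower X.ring Y.ring (Fin n → M.obj Y) :=
      ⟨fun a b n => mul_smul (ringHom f a) b n⟩
    exact isBaseChange_pow (M.isBaseChange f) n (LinearEquiv.refl _ _) _ fun m i => rfl

section RingMaps

variable {A B : Type u} [CommRing A] [CommRing B]

def tensorAlgebraMap (f : A →+* B) {M N : Type u} [AddCommGroup M] [AddCommGroup N] [Module A M]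
    [Module B N] (φ : M →ₛₗ[f] N) : TensorAlgebra A M →+* TensorAlgebra B N :=
  letI : Algebra A (TensorAlgebra B N) := Algebra.compHom _ f
  (TensorAlgebra.lift A
    ({ toFun := fun m => TensorAlgebra.ι B (φ m)
       map_add' := fun m m' => by rw [map_add, map_add]
       map_smul' := fun a m => by rw [map_smulₛₗ, map_smul]; rfl } :
      M →ₗ[A] TensorAlgebra B N)).toRingHom

theorem tensorAlgebraMap_ι (f : A →+* B) {M N : Type u} [AddCommGroup M] [AddCommGroup N]
    [Module A M] [Module B N] (φ : M →ₛₗ[f] N) (m : M) :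
    tensorAlgebraMap f φ (TensorAlgebra.ι A m) = TensorAlgebra.ι B (φ m) :=
  letI : Algebra A (TensorAlgebra B N) := Algebra.compHom _ f
  TensorAlgebra.lift_ι_apply _ _

theorem tensorAlgebraMap_algebraMap (f : A →+* B) {M N : Type u} [AddCommGroup M] [AddCommGroup N]
    [Module A M] [Module B N] (φ : M →ₛₗ[f] N) (a : A) :
    tensorAlgebraMap f φ (algebraMap A _ a) = algebraMap B _ (f a) :=
  letI : Algebra A (TensorAlgebra B N) := Algebra.compHom _ f
  AlgHom.commutes _ a

theorem tensorAlgebra_ringHom_ext {M R : Type u} [AddCommGroup M] [Module A M] [Ring R]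
    {g g' : TensorAlgebra A M →+* R} (h : ∀ a, g (algebraMap A _ a) = g' (algebraMap A _ a))
    (h' : ∀ m, g (TensorAlgebra.ι A m) = g' (TensorAlgebra.ι A m)) (x : TensorAlgebra A M) :
    g x = g' x := by
  induction x using TensorAlgebra.induction with
  | algebraMap a => exact h a
  | ι m => exact h' m
  | mul x y hx hy => rw [map_mul, map_mul, hx, hy]
  | add x y hx hy => rw [map_add, map_add, hx, hy]

open LinearAlgebra

def freeProductMap (f : A →+* B) {I : Type} [DecidableEq I] {R R' : I → Type u} [∀ i, Ring (R i)]
    [∀ i, Ring (R' i)] [∀ i, Algebra A (R i)] [∀ i, Algebra B (R' i)] (φ : ∀ i, R i →+* R' i)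
    (h : ∀ i a, φ i (algebraMap A (R i) a) = algebraMap B (R' i) (f a)) :
    FreeProduct A R →+* FreeProduct B R' :=
  letI : Algebra A (FreeProduct B R') := Algebra.compHom _ f
  (FreeProduct.lift A R (fun {i} =>
    ({ ((FreeProduct.ι B R' i : R' i →+* FreeProduct B R').comp (φ i)) with
        commutes' := fun a =>
          (congrArg (FreeProduct.ι B R' i) (h i a)).trans (AlgHom.commutes _ (f a)) } :
      R i →ₐ[A] FreeProduct B R'))).toRingHom

theorem freeProductMap_ι (f : A →+* B) {I : Type} [DecidableEq I] {R R' : I → Type u}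
    [∀ i, Ring (R i)] [∀ i, Ring (R' i)] [∀ i, Algebra A (R i)] [∀ i, Algebra B (R' i)]
    (φ : ∀ i, R i →+* R' i) (h : ∀ i a, φ i (algebraMap A (R i) a) = algebraMap B (R' i) (f a))
    (i : I) (r : R i) :
    freeProductMap f φ h (FreeProduct.ι A R i r) = FreeProduct.ι B R' i (φ i r) :=
  letI : Algebra A (FreeProduct B R') := Algebra.compHom _ f
  DFunLike.congr_fun (FreeProduct.lift_comp_ι A R (fun {i} =>
    ({ ((FreeProduct.ι B R' i : R' i →+* FreeProduct B R').comp (φ i)) with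
        commutes' := fun a =>
          (congrArg (FreeProduct.ι B R' i) (h i a)).trans (AlgHom.commutes _ (f a)) } :
      R i →ₐ[A] FreeProduct B R'))) r

theorem freeProductMap_algebraMap (f : A →+* B) {I : Type} [DecidableEq I] {R R' : I → Type u}
    [∀ i, Ring (R i)] [∀ i, Ring (R' i)] [∀ i, Algebra A (R i)] [∀ i, Algebra B (R' i)]
    (φ : ∀ i, R i →+* R' i) (h : ∀ i a, φ i (algebraMap A (R i) a) = algebraMap B (R' i) (f a))
    (a : A) :
    freeProductMap f φ h (algebraMap A _ a) = algebraMap B _ (f a) :=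
  letI : Algebra A (FreeProduct B R') := Algebra.compHom _ f
  AlgHom.commutes _ a

theorem freeProduct_ringHom_ext {I : Type} [DecidableEq I] {R : I → Type u}
    [∀ i, Ring (R i)] [∀ i, Algebra A (R i)] {C : Type u} [Ring C]
    {g g' : FreeProduct A R →+* C} (h : ∀ a, g (algebraMap A _ a) = g' (algebraMap A _ a))
    (h' : ∀ i r, g (FreeProduct.ι A R i r) = g' (FreeProduct.ι A R i r)) (x : FreeProduct A R) :
    g x = g' x := by
  let E : Subalgebra A (FreeProduct A R) :=
    { carrier := {x | g x = g' x}
      mul_mem' := fun {x y} hx hy => by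
        change g (x * y) = g' (x * y)
        rw [map_mul, map_mul, hx, hy]
      add_mem' := fun {x y} hx hy => by
        change g (x + y) = g' (x + y)
        rw [map_add, map_add, hx, hy]
      algebraMap_mem' := h }
  let l : FreeProduct A R →ₐ[A] E :=
    FreeProduct.lift A R (fun {i} => (FreeProduct.ι A R i).codRestrict E (h' i))
  have hl : E.val.comp l = AlgHom.id A _ := by
    refine (FreeProduct.lift A R).symm.injective ?_
    funext i
    refine AlgHom.ext fun r => ?_
    exact congrArg E.val (DFunLike.congr_fun (FreeProduct.lift_comp_ι A R
      (fun {i} => (FreeProduct.ι A R i).codRestrict E (h' i))) r)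
  have hx : E.val (l x) = x := DFunLike.congr_fun hl x
  rw [← hx]
  exact (l x).2

def dividedPowerMap (f : A →+* B) {M N : Type u} [AddCommGroup M] [AddCommGroup N] [Module A M]
    [Module B N] (φ : M →ₛₗ[f] N) : DividedPowerAlgebra A M →+* DividedPowerAlgebra B N :=
  letI : Algebra A (DividedPowerAlgebra B N) := Algebra.compHom _ f
  (DividedPowerAlgebra.lift' (R := A) (M := M) (A := DividedPowerAlgebra B N)
    (f := fun p => DividedPowerAlgebra.dp B p.1 (φ p.2))
    (fun _ => DividedPowerAlgebra.dp_zero)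
    (fun n a m => by rw [map_smulₛₗ, DividedPowerAlgebra.dp_smul, ← map_pow]; rfl)
    (fun _ _ _ => DividedPowerAlgebra.dp_mul)
    (fun _ _ _ => by rw [map_add, DividedPowerAlgebra.dp_add])).toRingHom

theorem dividedPowerMap_dp (f : A →+* B) {M N : Type u} [AddCommGroup M] [AddCommGroup N]
    [Module A M] [Module B N] (φ : M →ₛₗ[f] N) (n : ℕ) (m : M) :
    dividedPowerMap f φ (DividedPowerAlgebra.dp A n m) = DividedPowerAlgebra.dp B n (φ m) :=
  letI : Algebra A (DividedPowerAlgebra B N) := Algebra.compHom _ f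
  DividedPowerAlgebra.lift'_apply_dp (R := A) (M := M) (A := DividedPowerAlgebra B N)
    (f := fun p => DividedPowerAlgebra.dp B p.1 (φ p.2)) _ _ _ _ n m

theorem dividedPowerMap_algebraMap (f : A →+* B) {M N : Type u} [AddCommGroup M] [AddCommGroup N]
    [Module A M] [Module B N] (φ : M →ₛₗ[f] N) (a : A) :
    dividedPowerMap f φ (algebraMap A _ a) = algebraMap B _ (f a) :=
  letI : Algebra A (DividedPowerAlgebra B N) := Algebra.compHom _ f
  AlgHom.commutes _ a

theorem dividedPower_ringHom_ext {M R : Type u} [AddCommGroup M] [Module A M] [Ring R]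
    {g g' : DividedPowerAlgebra A M →+* R}
    (h : ∀ a, g (algebraMap A _ a) = g' (algebraMap A _ a))
    (h' : ∀ n m, g (DividedPowerAlgebra.dp A n m) = g' (DividedPowerAlgebra.dp A n m))
    (x : DividedPowerAlgebra A M) : g x = g' x := by
  induction x using DividedPowerAlgebra.induction_on with
  | C a => exact h a
  | add x y hx hy => rw [map_add, map_add, hx, hy]
  | dp x n m hx => rw [map_mul, map_mul, hx, h']

theorem isBaseChangeAlong_tensorAlgebra (f : A →+* B) {M N : Type u} [AddCommGroup M]
    [AddCommGroup N] [Module A M] [Module B N] {φ : M →ₛₗ[f] N} (hφ : IsBaseChangeAlong f φ)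
    {T : Type u} [Ring T] [Algebra B T] (e : T ≃ₐ[B] TensorAlgebra B N)
    (k : TensorAlgebra A M →+* T) (hk : ∀ a, k (algebraMap A _ a) = algebraMap B T (f a))
    (hk' : ∀ m, k (TensorAlgebra.ι A m) = e.symm (TensorAlgebra.ι B (φ m))) :
    IsBaseChangeAlong f (semilinearOfRingHom f k hk) := by
  let _ := f.toAlgebra
  let _ : Module A N := Module.compHom _ f
  have : IsScalarTower A B N := ⟨fun a b n => mul_smul (f a) b n⟩
  let _ : Algebra A T := Algebra.compHom _ f
  have : IsScalarTower A B T := ⟨fun a b n => mul_smul (f a) b n⟩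
  exact isBaseChange_tensorAlgebra hφ e { k with commutes' := hk } hk'

theorem isBaseChangeAlong_freeProduct (f : A →+* B) {I : Type} [DecidableEq I]
    {R R' : I → Type u} [∀ i, Ring (R i)] [∀ i, Ring (R' i)] [∀ i, Algebra A (R i)]
    [∀ i, Algebra B (R' i)] {φ : ∀ i, R i →+* R' i}
    {h : ∀ i a, φ i (algebraMap A (R i) a) = algebraMap B (R' i) (f a)}
    (hφ : ∀ i, IsBaseChangeAlong f (semilinearOfRingHom f (φ i) (h i)))
    {T : Type u} [Ring T] [Algebra B T] (e : T ≃ₐ[B] FreeProduct B R')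
    (k : FreeProduct A R →+* T) (hk : ∀ a, k (algebraMap A _ a) = algebraMap B T (f a))
    (hk' : ∀ i r, k (FreeProduct.ι A R i r) = e.symm (FreeProduct.ι B R' i (φ i r))) :
    IsBaseChangeAlong f (semilinearOfRingHom f k hk) := by
  let _ := f.toAlgebra
  let _ : ∀ i, Algebra A (R' i) := fun i => Algebra.compHom _ f
  have : ∀ i, IsScalarTower A B (R' i) := fun i => ⟨fun a b n => mul_smul (f a) b n⟩
  let _ : Algebra A T := Algebra.compHom _ f
  have : IsScalarTower A B T := ⟨fun a b n => mul_smul (f a) b n⟩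
  exact isBaseChange_freeProduct (f := fun i => { φ i with commutes' := h i }) hφ e
    { k with commutes' := hk } hk'

theorem isBaseChangeAlong_dividedPowerAlgebra (f : A →+* B) {M N : Type u} [AddCommGroup M]
    [AddCommGroup N] [Module A M] [Module B N] {φ : M →ₛₗ[f] N} (hφ : IsBaseChangeAlong f φ)
    {T : Type u} [CommRing T] [Algebra B T] (e : T ≃ₐ[B] DividedPowerAlgebra B N)
    (k : DividedPowerAlgebra A M →+* T) (hk : ∀ a, k (algebraMap A _ a) = algebraMap B T (f a))
    (hk' : ∀ n m, k (DividedPowerAlgebra.dp A n m) =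
      e.symm (DividedPowerAlgebra.dp B n (φ m))) :
    IsBaseChangeAlong f (semilinearOfRingHom f k hk) := by
  let _ := f.toAlgebra
  let _ : Module A N := Module.compHom _ f
  have : IsScalarTower A B N := ⟨fun a b n => mul_smul (f a) b n⟩
  let _ : Algebra A T := Algebra.compHom _ f
  have : IsScalarTower A B T := ⟨fun a b n => mul_smul (f a) b n⟩
  exact isBaseChange_dividedPowerAlgebra hφ e { k with commutes' := hk } hk'

end RingMaps

end Sheaves

noncomputable section Constructions

open AffinePoint LinearAlgebra

variable {S : Scheme.{u}}

/-- The tensor algebra `T(M)`, the free sheaf of algebras on `M`. -/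
def QCohAlg.tensorAlgebra (M : QCoh S) : QCohAlg S where
  obj X := TensorAlgebra X.ring (M.obj X)
  map f := tensorAlgebraMap (ringHom f) (M.map f)
  map_algebraMap f := tensorAlgebraMap_algebraMap (ringHom f) (M.map f)
  map_id X := tensorAlgebra_ringHom_ext (g' := RingHom.id _)
    (fun a => tensorAlgebraMap_algebraMap _ _ a)
    (fun m => by rw [tensorAlgebraMap_ι, M.map_id]; rfl)
  map_comp f g := tensorAlgebra_ringHom_ext
    (g' := (tensorAlgebraMap (ringHom g) (M.map g)).comp (tensorAlgebraMap (ringHom f) (M.map f)))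
    (fun a => by
      rw [RingHom.comp_apply, tensorAlgebraMap_algebraMap, tensorAlgebraMap_algebraMap,
        tensorAlgebraMap_algebraMap, ringHom_comp])
    (fun m => by
      rw [RingHom.comp_apply, tensorAlgebraMap_ι, tensorAlgebraMap_ι, tensorAlgebraMap_ι,
        M.map_comp])
  isBaseChange f := isBaseChangeAlong_tensorAlgebra (ringHom f) (M.isBaseChange f) AlgEquiv.refl _ _
    (fun m => tensorAlgebraMap_ι (ringHom f) (M.map f) m)

/-- The canonical morphism `M ⟶ T(M)`. -/
def QCohAlg.ofModule (M : QCoh S) : M ⟶ (QCohAlg.tensorAlgebra M).toQCoh where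
  app X := TensorAlgebra.ι X.ring
  naturality f m := (tensorAlgebraMap_ι (ringHom f) (M.map f) m).symm

/-- The morphism of algebras `T(M) ⟶ R` induced by a linear morphism `M ⟶ R`. -/
def QCohAlg.tensorLift {M : QCoh S} {R : QCohAlg S} (φ : M ⟶ R.toQCoh) :
    QCohAlg.tensorAlgebra M ⟶ R where
  app X := TensorAlgebra.lift X.ring (φ.app X)
  naturality {X Y} f := tensorAlgebra_ringHom_ext
    (g := (TensorAlgebra.lift Y.ring (A := R.obj Y) (φ.app Y)).toRingHom.comp
      (tensorAlgebraMap (ringHom f) (M.map f)))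
    (g' := (R.map f).comp (TensorAlgebra.lift X.ring (A := R.obj X) (φ.app X)).toRingHom)
    (fun a => by
      rw [RingHom.comp_apply, tensorAlgebraMap_algebraMap]
      exact (AlgHom.commutes _ _).trans ((R.map_algebraMap f a).symm.trans
        (congrArg (R.map f) (AlgHom.commutes (TensorAlgebra.lift X.ring (A := R.obj X) (φ.app X)) a).symm)))
    (fun m => by
      rw [RingHom.comp_apply, tensorAlgebraMap_ι]
      exact (TensorAlgebra.lift_ι_apply _ _).trans ((φ.naturality f m).trans
        (congrArg (R.map f) (TensorAlgebra.lift_ι_apply (A := R.obj X) (φ.app X) m).symm)))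

section FreeProduct

variable {I : Type} [DecidableEq I]

/-- The free product of a family of sheaves of algebras, which is their coproduct. -/
def QCohAlg.freeProduct (R : I → QCohAlg S) : QCohAlg S where
  obj X := FreeProduct X.ring fun i => (R i).obj X
  map f := freeProductMap (ringHom f) (fun i => (R i).map f) (fun i => (R i).map_algebraMap f)
  map_algebraMap f := freeProductMap_algebraMap (ringHom f) _ _
  map_id X := freeProduct_ringHom_ext (g' := RingHom.id _)
    (fun a => freeProductMap_algebraMap _ _ _ a)
    (fun i r => by rw [freeProductMap_ι, (R i).map_id]; rfl)
  map_comp f g := freeProduct_ringHom_ext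
    (g' := (freeProductMap (ringHom g) (fun i => (R i).map g)
      (fun i => (R i).map_algebraMap g)).comp
        (freeProductMap (ringHom f) (fun i => (R i).map f) (fun i => (R i).map_algebraMap f)))
    (fun a => by
      rw [RingHom.comp_apply, freeProductMap_algebraMap, freeProductMap_algebraMap,
        freeProductMap_algebraMap, ringHom_comp])
    (fun i r => by
      rw [RingHom.comp_apply, freeProductMap_ι, freeProductMap_ι, freeProductMap_ι,
        (R i).map_comp])
  isBaseChange f := isBaseChangeAlong_freeProduct (ringHom f) (fun i => (R i).isBaseChange f)
    AlgEquiv.refl _ _ (fun i r => freeProductMap_ι (ringHom f) (fun i => (R i).map f)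
      (fun i => (R i).map_algebraMap f) i r)

/-- The canonical morphism of a factor to the free product. -/
def QCohAlg.inj (R : I → QCohAlg S) (i : I) : R i ⟶ QCohAlg.freeProduct R where
  app X := FreeProduct.ι X.ring (fun i => (R i).obj X) i
  naturality f r := (freeProductMap_ι (ringHom f) (fun i => (R i).map f)
    (fun i => (R i).map_algebraMap f) i r).symm

/-- The morphism out of the free product given by morphisms out of the factors. -/
def QCohAlg.desc {R : I → QCohAlg S} {C : QCohAlg S} (φ : ∀ i, R i ⟶ C) :
    QCohAlg.freeProduct R ⟶ C where
  app X := FreeProduct.lift X.ring (fun i => (R i).obj X) (fun {i} => (φ i).app X)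
  naturality {X Y} f := freeProduct_ringHom_ext
    (g := (FreeProduct.lift Y.ring (fun i => (R i).obj Y) (fun {i} => (φ i).app Y)).toRingHom.comp
      (freeProductMap (ringHom f) (fun i => (R i).map f) (fun i => (R i).map_algebraMap f)))
    (g' := (C.map f).comp
      (FreeProduct.lift X.ring (fun i => (R i).obj X) (fun {i} => (φ i).app X)).toRingHom)
    (fun a => by
      rw [RingHom.comp_apply, freeProductMap_algebraMap]
      exact (AlgHom.commutes _ _).trans ((C.map_algebraMap f a).symm.trans
        (congrArg (C.map f) (AlgHom.commutes (FreeProduct.lift X.ring (fun i => (R i).obj X)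
          (fun {i} => (φ i).app X)) a).symm)))
    (fun i r => by
      rw [RingHom.comp_apply, freeProductMap_ι]
      exact (DFunLike.congr_fun (FreeProduct.lift_comp_ι Y.ring (fun i => (R i).obj Y)
        (fun {i} => (φ i).app Y)) ((R i).map f r)).trans (((φ i).naturality f r).trans
          (congrArg (C.map f) (DFunLike.congr_fun (FreeProduct.lift_comp_ι X.ring
            (fun i => (R i).obj X) (fun {i} => (φ i).app X)) r).symm)))

end FreeProduct

/-- The sheaf `Γ(M)` of divided power algebras, as a quasi-coherent sheaf of modules. The summand
`Γⁿ(M)` is generated by the products of divided powers of total degree `n`. -/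
def QCoh.gamma (M : QCoh S) : QCoh S where
  obj X := DividedPowerAlgebra X.ring (M.obj X)
  map f := semilinearOfRingHom (ringHom f) (dividedPowerMap (ringHom f) (M.map f))
    (dividedPowerMap_algebraMap (ringHom f) (M.map f))
  map_id X := dividedPower_ringHom_ext (g := dividedPowerMap (ringHom (𝟙 X)) (M.map (𝟙 X)))
    (g' := RingHom.id _)
    (fun a => dividedPowerMap_algebraMap _ _ a)
    (fun n m => by rw [dividedPowerMap_dp, M.map_id]; rfl)
  map_comp f g := dividedPower_ringHom_ext
    (g := dividedPowerMap (ringHom (f ≫ g)) (M.map (f ≫ g)))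
    (g' := (dividedPowerMap (ringHom g) (M.map g)).comp (dividedPowerMap (ringHom f) (M.map f)))
    (fun a => by
      rw [RingHom.comp_apply, dividedPowerMap_algebraMap, dividedPowerMap_algebraMap,
        dividedPowerMap_algebraMap, ringHom_comp])
    (fun n m => by
      rw [RingHom.comp_apply, dividedPowerMap_dp, dividedPowerMap_dp, dividedPowerMap_dp,
        M.map_comp])
  isBaseChange f := isBaseChangeAlong_dividedPowerAlgebra (ringHom f) (M.isBaseChange f)
    AlgEquiv.refl _ _ (fun n m => dividedPowerMap_dp (ringHom f) (M.map f) n m)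

end Constructions

noncomputable section PolynomialLaws

open AffinePoint Limits

variable {S : Scheme.{u}}

/-- A polynomial law `M ⇝ N`: a natural transformation of the underlying presheaves of sets. -/
@[ext]
structure Law (M N : QCoh S) where
  app : ∀ X, M.obj X → N.obj X
  naturality : ∀ {X Y : AffinePoint S} (f : X ⟶ Y) (m : M.obj X),
    app Y (M.map f m) = N.map f (app X m)

namespace Law

protected def id (M : QCoh S) : Law M M where
  app _ m := m
  naturality _ _ := rfl

/-- The composite of `φ : M ⇝ N` followed by `ψ : N ⇝ P`. -/
def comp {M N P : QCoh S} (φ : Law M N) (ψ : Law N P) : Law M P where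
  app X m := ψ.app X (φ.app X m)
  naturality f m := by rw [φ.naturality, ψ.naturality]

/-- A linear morphism, regarded as a polynomial law. -/
def ofHom {M N : QCoh S} (φ : M ⟶ N) : Law M N where
  app X := φ.app X
  naturality := φ.naturality

/-- A morphism of algebras, regarded as a polynomial law. -/
def ofAlgHom {R R' : QCohAlg S} (φ : R ⟶ R') :
    Law R.toQCoh R'.toQCoh :=
  ofHom (QCohAlg.toHom φ)

/-- Homogeneity of degree `n`: `ψ (a z) = aⁿ ψ z`. -/
def IsHomogeneous {M N : QCoh S} (ψ : Law M N) (n : ℕ) : Prop :=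
  ∀ (X : AffinePoint S) (a : X.ring) (z : M.obj X), ψ.app X (a • z) = a ^ n • ψ.app X z

/-- `ψ` is the sum of the locally finite family `ψ₀, ψ₁, ψ₂, …`. -/
def IsSum {M N : QCoh S} (ψ : Law M N) (ψs : ℕ → Law M N) : Prop :=
  ∀ (X : AffinePoint S) (z : M.obj X),
    (Function.support fun n => (ψs n).app X z).Finite ∧
      ψ.app X z = ∑ᶠ n, (ψs n).app X z

/-- The linear morphism `α : Γ(M) ⟶ N` is induced by the law `ψ : M ⇝ N`: if `ψ = ∑ ψₙ` is the
decomposition into homogeneous components, then `α` is the linear morphism whose restriction to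
`Γⁿ(M)` corresponds to `ψₙ`, that is, `α (z^[n]) = ψₙ z`. -/
def Induces {M N : QCoh S} (ψ : Law M N) (α : M.gamma ⟶ N) : Prop :=
  ∃ ψs : ℕ → Law M N, (∀ n, (ψs n).IsHomogeneous n) ∧ ψ.IsSum ψs ∧
    ∀ (n : ℕ) (X : AffinePoint S) (z : M.obj X),
      α.app X (DividedPowerAlgebra.dp X.ring n z : DividedPowerAlgebra X.ring (M.obj X)) =
        (ψs n).app X z

/-- `b₀ a ^ d + b₁ a ^ (d - 1) + ⋯ + b_{d-1} a`. -/
def weightedSum {d : ℕ} {R : Type u} [Ring R] (a : R) (b : Fin d → R) : R :=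
  ∑ i : Fin d, b i * a ^ (d - (i : ℕ))

/-- The law `b₀ a ^ d + b₁ a ^ (d - 1) + ⋯ + b_{d-1} a` with values in an algebra. -/
def weighted {d : ℕ} {M : QCoh S} {R : QCohAlg S} (a : Law M R.toQCoh)
    (b : Fin d → Law M R.toQCoh) : Law M R.toQCoh where
  app X z := weightedSum (a.app X z) fun i => (b i).app X z
  naturality {X Y} f z := by
    change _ = R.map f _
    simp only [weightedSum]
    rw [map_sum]
    refine Finset.sum_congr rfl fun i _ => ?_
    rw [map_mul, map_pow, (b i).naturality, a.naturality]
    rfl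

/-- The `i`-th coordinate projection. -/
def proj (M : QCoh S) (n : ℕ) (i : Fin n) : Law (M.pow n) M where
  app _ m := m i
  naturality _ _ := rfl

/-- The direct sum of `n` copies of a law. -/
def pow {M N : QCoh S} (ψ : Law M N) (n : ℕ) : Law (M.pow n) (N.pow n) where
  app X m i := ψ.app X (m i)
  naturality f m := funext fun i => ψ.naturality f (m i)

end Law

/-- `φ ⊗ ψ`. -/
def QCoh.tensorHom {M M' N N' : QCoh S} (φ : M ⟶ M') (ψ : N ⟶ N') :
    M.tensor N ⟶ M'.tensor N' where
  app X := TensorProduct.map (φ.app X) (ψ.app X)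
  naturality {X Y} f t := by
    change TensorProduct.map (φ.app Y) (ψ.app Y) (TensorProduct.map (M.map f) (N.map f) t) =
      TensorProduct.map (M'.map f) (N'.map f) (TensorProduct.map (φ.app X) (ψ.app X) t)
    induction t using TensorProduct.induction_on with
    | zero => simp only [map_zero]
    | tmul m n => simp only [TensorProduct.map_tmul, φ.naturality, ψ.naturality]
    | add x y hx hy => simp only [map_add, hx, hy]

/-- The commutator `R ⊗ R ⟶ R`, `x ⊗ y ↦ x y - y x`. -/
def QCohAlg.commutator (R : QCohAlg S) :
    R.toQCoh.tensor R.toQCoh ⟶ R.toQCoh where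
  app X := TensorProduct.lift
    (LinearMap.mul X.ring (R.obj X) - (LinearMap.mul X.ring (R.obj X)).flip)
  naturality {X Y} f t := by
    change TensorProduct.lift _ (TensorProduct.map _ _ t) = R.map f (TensorProduct.lift _ t)
    induction t using TensorProduct.induction_on with
    | zero => simp only [map_zero]
    | tmul x y =>
      change R.map f x * R.map f y - R.map f y * R.map f x = R.map f (x * y - y * x)
      rw [map_sub, map_mul, map_mul]
    | add x y hx hy => simp only [map_add, hx, hy]

/-- An object `(F, A₋₂, G, A₀, …, A_{d-1}, A_d, ψ₋₂, ψ₋₁, ψ₀, …, ψ_{d-1}, ψ_d)` of the category of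
weighted polynomial laws. The entries with index `0, …, d - 1` are the families `A`, `ψ`; those
with index `d` are `Alast`, `ψlast`. -/
structure WPoly (S : Scheme.{u}) (d : ℕ) where
  F : QCoh S
  Aneg2 : QCohAlg S
  G : QCoh S
  A : Fin d → QCohAlg S
  Alast : QCohAlg S
  ψneg2 : G.tensor G ⟶ Aneg2.toQCoh
  ψneg1 : Law F G
  ψ : ∀ i, Law F (A i).toQCoh
  ψlast : Law F Alast.toQCoh

namespace WPoly

variable {d : ℕ}

/-- A morphism of weighted polynomial laws: a polynomial law `u`, a linear morphism `u₋₁` and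
morphisms of algebras `u₋₂, u₀, …, u_d`, compatible with the weights. -/
@[ext]
structure Hom (Ψ Ψ' : WPoly S d) where
  u : Law Ψ.F Ψ'.F
  uneg2 : Ψ.Aneg2 ⟶ Ψ'.Aneg2
  uneg1 : Ψ.G ⟶ Ψ'.G
  uA : ∀ i, Ψ.A i ⟶ Ψ'.A i
  ulast : Ψ.Alast ⟶ Ψ'.Alast
  comm_neg2 : Ψ.ψneg2 ≫ QCohAlg.toHom uneg2 = QCoh.tensorHom uneg1 uneg1 ≫ Ψ'.ψneg2
  comm_neg1 : Ψ.ψneg1.comp (Law.ofHom uneg1) = u.comp Ψ'.ψneg1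
  comm : ∀ i, (Ψ.ψ i).comp (Law.ofAlgHom (uA i)) = u.comp (Ψ'.ψ i)
  comm_last : Ψ.ψlast.comp (Law.ofAlgHom ulast) = u.comp Ψ'.ψlast

theorem tensorHom_id (M N : QCoh S) : QCoh.tensorHom (𝟙 M) (𝟙 N) = 𝟙 (M.tensor N) := by
  refine QCoh.Hom.ext (funext fun X => ?_)
  exact TensorProduct.map_id

theorem tensorHom_comp {M M' M'' : QCoh S} (φ : M ⟶ M') (ψ : M' ⟶ M'') :
    QCoh.tensorHom (φ ≫ ψ) (φ ≫ ψ) = QCoh.tensorHom φ φ ≫ QCoh.tensorHom ψ ψ := by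
  refine QCoh.Hom.ext (funext fun X => ?_)
  exact TensorProduct.map_comp _ _ _ _

instance : Category (WPoly S d) where
  Hom := Hom
  id Ψ :=
    { u := Law.id Ψ.F
      uneg2 := 𝟙 _
      uneg1 := 𝟙 _
      uA := fun _ => 𝟙 _
      ulast := 𝟙 _
      comm_neg2 := by rw [tensorHom_id]; rfl
      comm_neg1 := rfl
      comm := fun _ => rfl
      comm_last := rfl }
  comp {Ψ Ψ' Ψ''} p q :=
    { u := p.u.comp q.u
      uneg2 := p.uneg2 ≫ q.uneg2
      uneg1 := p.uneg1 ≫ q.uneg1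
      uA := fun i => p.uA i ≫ q.uA i
      ulast := p.ulast ≫ q.ulast
      comm_neg2 := by
        rw [tensorHom_comp, Category.assoc, ← q.comm_neg2, ← Category.assoc, ← p.comm_neg2]
        rfl
      comm_neg1 :=
        (congrArg (fun l => Law.comp l (Law.ofHom q.uneg1)) p.comm_neg1).trans
          (congrArg (Law.comp p.u) q.comm_neg1)
      comm := fun i =>
        (congrArg (fun l => Law.comp l (Law.ofAlgHom (q.uA i))) (p.comm i)).trans
          (congrArg (Law.comp p.u) (q.comm i))
      comm_last :=
        (congrArg (fun l => Law.comp l (Law.ofAlgHom q.ulast)) p.comm_last).trans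
          (congrArg (Law.comp p.u) q.comm_last) }

variable (S d) in
/-- The functor `R ↦ (R ^ (d + 1), R, …, R, pr₋₂, …, pr_d)`. A section of `R ^ (d + 1)` is written
`(a₋₁, a₀, …, a_{d-1})`, so that coordinate `0 : Fin (d + 1)` is `a₋₁` and coordinate `i.succ` is
`a_i`; `pr₋₂` is the commutator, `pr₋₁, …, pr_{d-1}` are the coordinate projections and `pr_d` is
`a₀ a₋₁ ^ d + a₁ a₋₁ ^ (d - 1) + ⋯ + a_{d-1} a₋₁`. -/
def ofAlg : QCohAlg S ⥤ WPoly S d where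
  obj R :=
    { F := R.toQCoh.pow (d + 1)
      Aneg2 := R
      G := R.toQCoh
      A := fun _ => R
      Alast := R
      ψneg2 := R.commutator
      ψneg1 := Law.proj _ (d + 1) 0
      ψ := fun i => Law.proj _ (d + 1) i.succ
      ψlast := Law.weighted (Law.proj _ (d + 1) 0) fun i : Fin d => Law.proj _ (d + 1) i.succ }
  map {R R'} φ :=
    { u := (Law.ofAlgHom φ).pow (d + 1)
      uneg2 := φ
      uneg1 := QCohAlg.toHom φ
      uA := fun _ => φ
      ulast := φ
      comm_neg2 := by
        refine QCoh.Hom.ext (funext fun X => TensorProduct.ext' fun (x y : R.obj X) => ?_)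
        change φ.app X (x * y - y * x) = φ.app X x * φ.app X y - φ.app X y * φ.app X x
        rw [map_sub, map_mul, map_mul]
      comm_neg1 := rfl
      comm := fun _ => rfl
      comm_last := by
        refine Law.ext (funext fun X => funext fun (a : Fin (d + 1) → R.obj X) => ?_)
        change φ.app X (Law.weightedSum (a 0) fun i : Fin d => a i.succ) =
          Law.weightedSum (φ.app X (a 0)) fun i : Fin d => φ.app X (a i.succ)
        simp only [Law.weightedSum, map_sum, map_mul, map_pow] }

variable (Ψ : WPoly S d)

/-- The algebras `A₀, …, A_{d-1}, T(G)`. -/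
def factors : Option (Fin d) → QCohAlg S
  | some i => Ψ.A i
  | none => QCohAlg.tensorAlgebra Ψ.G

/-- The coproduct `A₀ * ⋯ * A_{d-1} * T(G)`. -/
def freeProd : QCohAlg S := QCohAlg.freeProduct Ψ.factors

/-- The inclusion `A_i ⟶ A₀ * ⋯ * A_{d-1} * T(G)`. -/
def injA (i : Fin d) : Ψ.A i ⟶ Ψ.freeProd := QCohAlg.inj Ψ.factors (some i)

/-- The inclusion `T(G) ⟶ A₀ * ⋯ * A_{d-1} * T(G)`. -/
def injT : QCohAlg.tensorAlgebra Ψ.G ⟶ Ψ.freeProd := QCohAlg.inj Ψ.factors none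

/-- The law `ψ₀ ψ₋₁ ^ d + ψ₁ ψ₋₁ ^ (d - 1) + ⋯ + ψ_{d-1} ψ₋₁ : F ⇝ A₀ * ⋯ * A_{d-1} * T(G)`. -/
def mixedLaw : Law Ψ.F Ψ.freeProd.toQCoh :=
  Law.weighted
    ((Ψ.ψneg1.comp (Law.ofHom (QCohAlg.ofModule Ψ.G))).comp (Law.ofAlgHom Ψ.injT))
    fun i => (Ψ.ψ i).comp (Law.ofAlgHom (Ψ.injA i))

/-- `G ⊗ G ⟶ T(G)`, `m ⊗ n ↦ m ⊗ n - n ⊗ m`. -/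
def commutatorHom : Ψ.G.tensor Ψ.G ⟶ (QCohAlg.tensorAlgebra Ψ.G).toQCoh :=
  QCoh.tensorHom (QCohAlg.ofModule Ψ.G) (QCohAlg.ofModule Ψ.G) ≫
    (QCohAlg.tensorAlgebra Ψ.G).commutator

/-- The two sources `T(G ⊗ G)`, `T(Γ(F))` of the Clifford diagram. -/
inductive Source
  | tensor
  | gamma

/-- The three targets `A₋₂`, `A₀ * ⋯ * A_{d-1} * T(G)`, `A_d` of the Clifford diagram. -/
inductive Target
  | neg2
  | prod
  | last

/-- The shape `neg2 ← tensor → prod ← gamma → last`. -/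
def shape : MultispanShape where
  L := Source
  R := Target
  fst
    | .tensor => .neg2
    | .gamma => .last
  snd _ := .prod

/-- The diagram `A₋₂ ⟵ T(G ⊗ G) ⟶ A₀ * ⋯ * A_{d-1} * T(G) ⟵ T(Γ(F)) ⟶ A_d`, with the two arrows
out of `T(Γ(F))` given by linear morphisms `α` and `β` on `Γ(F)`. -/
def diagram (α : Ψ.F.gamma ⟶ Ψ.Alast.toQCoh)
    (β : Ψ.F.gamma ⟶ Ψ.freeProd.toQCoh) : MultispanIndex shape (QCohAlg S) where
  left
    | .tensor => QCohAlg.tensorAlgebra (Ψ.G.tensor Ψ.G)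
    | .gamma => QCohAlg.tensorAlgebra Ψ.F.gamma
  right
    | .neg2 => Ψ.Aneg2
    | .prod => Ψ.freeProd
    | .last => Ψ.Alast
  fst
    | .tensor => QCohAlg.tensorLift Ψ.ψneg2
    | .gamma => QCohAlg.tensorLift α
  snd
    | .tensor => QCohAlg.tensorLift Ψ.commutatorHom ≫ Ψ.injT
    | .gamma => QCohAlg.tensorLift β

variable {Ψ}

/-- The arrow `A₀ * ⋯ * A_{d-1} * T(G) ⟶ C` whose restrictions to `A₀, …, A_{d-1}` and to `G` are
the components of a morphism from `Ψ` to the weighted polynomial law of `C`. -/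
def prodLeg {C : QCohAlg S} (η : Ψ ⟶ (ofAlg S d).obj C) : Ψ.freeProd ⟶ C :=
  QCohAlg.desc fun
    | some i => η.uA i
    | none => QCohAlg.tensorLift η.uneg1

variable (α : Ψ.F.gamma ⟶ Ψ.Alast.toQCoh)
    (β : Ψ.F.gamma ⟶ Ψ.freeProd.toQCoh)

/-- The arrows from `A₋₂`, `A₀ * ⋯ * A_{d-1} * T(G)`, `A_d` to `C` given by a morphism from `Ψ` to
the weighted polynomial law of `C`. -/
def legs {C : QCohAlg S} (η : Ψ ⟶ (ofAlg S d).obj C) :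
    ∀ t, (Ψ.diagram α β).right t ⟶ C
  | .neg2 => η.uneg2
  | .prod => prodLeg η
  | .last => η.ulast

end WPoly

end PolynomialLaws

end PolyLaw

open PolyLaw CategoryTheory.Limits

/-!
Cocones with vertex `C` under the Clifford diagram correspond to morphisms from `Ψ` to the weighted
polynomial law `ofAlg C`, naturally in `C` (`WPoly.legs_condition`, `WPoly.exists_hom_of_legs`,
`WPoly.hom_ext_of_legs`, `WPoly.legs_comp`). Hence a universal morphism from `Ψ` is the same as a
colimit of that diagram, and the left adjoint exists because sheaves of algebras have colimits.

In this correspondence the polynomial law `u` of a morphism is determined by the other components,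
because its target is a power of `C` whose coordinates are part of the data. The square over
`T(G ⊗ G)` says that the morphism respects `ψ₋₂`. The square over `T(Γ(F))` says that two linear
morphisms on `Γ(F)` agree, and this amounts to the compatibility with `ψ_d` since a polynomial law
`M ⇝ N` is the same as the linear morphism `Γ(M) ⟶ N` which it induces
(`Law.existsUnique_induces`, `Law.Induces.injective`).

The last fact is due to Roby. It is proved here without the structure of `Γ` of a free module. For a
section `m` of `M`, let `∂_m^[n]` be the operator on laws for which `(∂_m^[n] ψ) z` is the coefficient
of `tⁿ` in `ψ (z + t m)`; such coefficients make sense because a section over `A[t]` of a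
quasi-coherent sheaf is a polynomial with coefficients in the sections over `A`. By Taylor's formula
these operators commute and satisfy the relations of divided powers, so that `Γ(M)` acts on laws
(`LawOver.dpAction`). The linear morphism induced by `ψ` sends `γ` to `(γ ψ) 0`. It is unique because
products of divided powers occur as coefficients of `(z + t y)^[n]` (`QCoh.gamma_hom_ext`).

Coproducts of sheaves of algebras are the free products. Coequalizers are formed sectionwise, and
they are quasi-coherent because the relations over `B` are the base change of those over `A`
(`isBaseChangeAlong_ringQuot`).
-/

namespace PolyLaw

noncomputable section

open AffinePoint

/-! ### Semilinear maps that are base changes -/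

section BaseChangeAlong

variable {A B : Type u} [CommRing A] [CommRing B] {f : A →+* B} {M N Q : Type u}
  [AddCommGroup M] [AddCommGroup N] [AddCommGroup Q] [Module A M] [Module B N] [Module B Q]
  {φ : M →ₛₗ[f] N}

theorem IsBaseChangeAlong.exists_lift (h : IsBaseChangeAlong f φ) (g : M →ₛₗ[f] Q) :
    ∃ g' : N →ₗ[B] Q, ∀ m, g' (φ m) = g m := by
  let _ := f.toAlgebra
  let _ : Module A N := Module.compHom N f
  let _ : Module A Q := Module.compHom Q f
  have : IsScalarTower A B N := ⟨fun a b n => mul_smul (f a) b n⟩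
  have : IsScalarTower A B Q := ⟨fun a b n => mul_smul (f a) b n⟩
  let g₀ : M →ₗ[A] Q := { toFun := g, map_add' := g.map_add, map_smul' := g.map_smulₛₗ }
  refine ⟨IsBaseChange.lift h g₀, fun m => ?_⟩
  exact IsBaseChange.lift_eq h g₀ m

theorem IsBaseChangeAlong.induction_on (h : IsBaseChangeAlong f φ) {P : N → Prop} (x : N)
    (zero : P 0) (add : ∀ x y, P x → P y → P (x + y)) (smul : ∀ (b : B) (m : M), P (b • φ m)) :
    P x := by
  let _ := f.toAlgebra
  let _ : Module A N := Module.compHom N f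
  have : IsScalarTower A B N := ⟨fun a b n => mul_smul (f a) b n⟩
  have h' : IsBaseChange B
      ({ toFun := φ, map_add' := φ.map_add, map_smul' := φ.map_smulₛₗ } : M →ₗ[A] N) := h
  obtain ⟨y, rfl⟩ := h'.equiv.surjective x
  induction y with
  | zero => rw [map_zero]; exact zero
  | tmul b m => rw [h'.equiv_tmul]; exact smul b m
  | add x y hx hy => rw [map_add]; exact add _ _ hx hy

theorem IsBaseChangeAlong.hom_ext (h : IsBaseChangeAlong f φ) {g g' : N →ₗ[B] Q}
    (hg : ∀ m, g (φ m) = g' (φ m)) : g = g' := by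
  refine LinearMap.ext fun x => ?_
  induction x using h.induction_on with
  | zero => rw [map_zero, map_zero]
  | add x y hx hy => rw [map_add, map_add, hx, hy]
  | smul b m => rw [map_smul, map_smul, hg]

end BaseChangeAlong

variable {S : Scheme.{u}}

/-! ### Sections over the affine line -/

namespace AffinePoint

variable {X Y Z : AffinePoint S}

/-- The affine line `(A[t], Spec A[t] ⟶ Spec A ⟶ S)` over the affine point `X = (A, x)`. -/
def poly (X : AffinePoint S) : AffinePoint S where
  ring := CommRingCat.of (Polynomial X.ring)
  pt := Spec.map (CommRingCat.ofHom Polynomial.C) ≫ X.pt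

/-- The inclusion of the constants `A → A[t]`. -/
def toPoly (X : AffinePoint S) : X ⟶ X.poly where
  hom := CommRingCat.ofHom Polynomial.C
  w := rfl

/-- The coordinate `t` of `A[t]`. -/
def param (X : AffinePoint S) : X.poly.ring := (Polynomial.X : Polynomial X.ring)

/-- The morphism `A[t] → B` that extends `f : A → B` and sends `t` to `b`. -/
def evalAt (f : X ⟶ Y) (b : Y.ring) : X.poly ⟶ Y where
  hom := CommRingCat.ofHom (Polynomial.eval₂RingHom (ringHom f) b)
  w := by
    have h : CommRingCat.ofHom Polynomial.C ≫
        CommRingCat.ofHom (Polynomial.eval₂RingHom (ringHom f) b) = f.hom :=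
      CommRingCat.hom_ext (RingHom.ext fun _ => Polynomial.eval₂_C _ _)
    exact (Spec.map_comp_assoc _ _ _).symm.trans ((congrArg (fun g => Spec.map g ≫ X.pt) h).trans
      f.w)

theorem hom_ext {f g : X ⟶ Y} (h : ∀ a, ringHom f a = ringHom g a) : f = g := by
  obtain ⟨f, hf⟩ := f
  obtain ⟨g, hg⟩ := g
  have : f = g := CommRingCat.hom_ext (RingHom.ext h)
  subst this
  rfl

theorem toPoly_evalAt (f : X ⟶ Y) (b : Y.ring) : X.toPoly ≫ evalAt f b = f :=
  hom_ext fun _ => Polynomial.eval₂_C _ _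

theorem ringHom_evalAt_param (f : X ⟶ Y) (b : Y.ring) : ringHom (evalAt f b) X.param = b :=
  Polynomial.eval₂_X _ _

/-- The morphism `A[t] → B[t]` that extends `f : A → B` and sends `t` to `t`. -/
def polyMap (f : X ⟶ Y) : X.poly ⟶ Y.poly := evalAt (f ≫ Y.toPoly) Y.param

theorem toPoly_polyMap (f : X ⟶ Y) : X.toPoly ≫ polyMap f = f ≫ Y.toPoly := toPoly_evalAt _ _

theorem ringHom_polyMap_param (f : X ⟶ Y) : ringHom (polyMap f) X.param = Y.param :=
  ringHom_evalAt_param _ _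

end AffinePoint

namespace QCoh

variable (N : QCoh S) {X Y : AffinePoint S}

/-- The `X.poly.ring`-module structure, seen by instance search under the name `Polynomial X.ring`. -/
instance : Module (Polynomial X.ring) (N.obj X.poly) := N.module X.poly

/-- The module over `A[t]` is identified with the module of polynomials with coefficients in the
module over `A`, through the universal property of base change. -/
theorem exists_toPolynomialModule (X : AffinePoint S) :
    ∃ g : N.obj X.poly →ₗ[Polynomial X.ring] PolynomialModule X.ring (N.obj X),
      ∀ y, g (N.map X.toPoly y) = PolynomialModule.single X.ring 0 y :=
  IsBaseChangeAlong.exists_lift (B := Polynomial X.ring)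
    (f := (Polynomial.C : X.ring →+* Polynomial X.ring)) (M := N.obj X)
    (N := N.obj X.poly) (φ := N.map X.toPoly) (N.isBaseChange X.toPoly)
    { toFun := PolynomialModule.single X.ring 0
      map_add' := PolynomialModule.single_add 0
      map_smul' := fun a m => by
        rw [← Polynomial.monomial_zero_left, PolynomialModule.monomial_smul_single, zero_add] }

/-- The family of coefficients of a section over `A[t]`: a section `x` over `A[t]` is uniquely a
finite sum `∑ tⁿ xₙ` with sections `xₙ` over `A`. -/
def coeffs : N.obj X.poly →+ (ℕ →₀ N.obj X) :=
  (PolynomialModule.coeffAddEquiv (R := X.ring)).toAddMonoidHom.comp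
    (N.exists_toPolynomialModule X).choose.toAddMonoidHom

theorem coeffs_smul_map (p : X.poly.ring) (y : N.obj X) (n : ℕ) :
    N.coeffs (p • N.map X.toPoly y) n = Polynomial.coeff (R := X.ring) p n • y := by
  let q : Polynomial X.ring := p
  change ((N.exists_toPolynomialModule X).choose (q • N.map X.toPoly y)).coeff n = q.coeff n • y
  rw [map_smul, (N.exists_toPolynomialModule X).choose_spec,
    PolynomialModule.smul_single_apply, if_pos (Nat.zero_le n), Nat.sub_zero]

theorem coeffs_param_pow_smul (k : ℕ) (x : N.obj X.poly) (n : ℕ) :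
    N.coeffs (X.param ^ k • x) n = if k ≤ n then N.coeffs x (n - k) else 0 := by
  change ((N.exists_toPolynomialModule X).choose ((Polynomial.X ^ k : Polynomial X.ring) • x)).coeff n
    = _
  rw [map_smul, ← Polynomial.monomial_one_right_eq_X_pow, PolynomialModule.monomial_smul_apply,
    one_smul]
  rfl

theorem coeffs_param_pow_smul_map (k : ℕ) (y : N.obj X) (n : ℕ) :
    N.coeffs (X.param ^ k • N.map X.toPoly y) n = if k = n then y else 0 := by
  rw [coeffs_smul_map]
  change ((Polynomial.X : Polynomial X.ring) ^ k).coeff n • y = _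
  rw [Polynomial.coeff_X_pow]
  simp [eq_comm]

theorem coeffs_smul (a : X.ring) (x : N.obj X.poly) (n : ℕ) :
    N.coeffs (ringHom X.toPoly a • x) n = a • N.coeffs x n := by
  change ((N.exists_toPolynomialModule X).choose ((Polynomial.C a : Polynomial X.ring) • x)).coeff n
    = _
  rw [map_smul, ← Polynomial.monomial_zero_left, PolynomialModule.monomial_smul_apply,
    if_pos (Nat.zero_le n)]
  rfl

theorem sum_coeffs (x : N.obj X.poly) :
    ((N.coeffs x).sum fun n y => X.param ^ n • N.map X.toPoly y) = x := by
  have hz : ∀ n : ℕ, X.param ^ n • N.map X.toPoly 0 = 0 := fun n => by rw [map_zero, smul_zero]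
  have ha : ∀ (n : ℕ) (y y' : N.obj X), X.param ^ n • N.map X.toPoly (y + y') =
      X.param ^ n • N.map X.toPoly y + X.param ^ n • N.map X.toPoly y' := fun n y y' => by
    rw [map_add, smul_add]
  have key : ∀ x y, ((N.coeffs (X := X) (x + y)).sum fun n y => X.param ^ n • N.map X.toPoly y) =
      ((N.coeffs x).sum fun n y => X.param ^ n • N.map X.toPoly y) +
      ((N.coeffs y).sum fun n y => X.param ^ n • N.map X.toPoly y) := fun x y => by
    rw [map_add, Finsupp.sum_add_index' hz ha]
  induction x using (N.isBaseChange X.toPoly).induction_on with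
  | zero => rw [map_zero, Finsupp.sum_zero_index]
  | add x y hx hy => rw [key, hx, hy]
  | smul b m =>
    induction (b : Polynomial X.ring) using Polynomial.induction_on' with
    | add p q hp hq =>
      have : (p + q : X.poly.ring) • N.map X.toPoly m = (show X.poly.ring from p) • N.map X.toPoly m +
        (show X.poly.ring from q) • N.map X.toPoly m := add_smul _ _ _
      exact (congrArg (fun x => (N.coeffs x).sum fun n y => X.param ^ n • N.map X.toPoly y)
        this).trans ((key _ _).trans ((congrArg₂ _ hp hq).trans this.symm))
    | monomial k a =>
      have h : ((Polynomial.monomial k a : Polynomial X.ring) : X.poly.ring) • N.map X.toPoly m =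
          X.param ^ k • N.map X.toPoly (a • m) := by
        rw [map_smulₛₗ, smul_smul]
        congr 1
        exact Polynomial.C_mul_X_pow_eq_monomial.symm.trans Polynomial.X_pow_mul.symm
      have h' : N.coeffs (X.param ^ k • N.map X.toPoly (a • m)) = Finsupp.single k (a • m) := by
        ext n
        rw [coeffs_param_pow_smul_map, Finsupp.single_apply]
      refine (congrArg (fun x => (N.coeffs x).sum fun n y => X.param ^ n • N.map X.toPoly y)
        h).trans (Eq.trans ?_ h.symm)
      rw [h', Finsupp.sum_single_index (hz k)]

theorem map_evalAt (f : X ⟶ Y) (b : Y.ring) (x : N.obj X.poly) :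
    N.map (evalAt f b) x = (N.coeffs x).sum fun n y => b ^ n • N.map f y := by
  conv_lhs => rw [← N.sum_coeffs x]
  rw [Finsupp.sum, map_sum]
  refine Finset.sum_congr rfl fun n _ => ?_
  rw [map_smulₛₗ, map_pow, ringHom_evalAt_param, ← N.map_comp, toPoly_evalAt]

theorem coeffs_sum (c : ℕ →₀ N.obj X) :
    N.coeffs (c.sum fun n y => X.param ^ n • N.map X.toPoly y) = c := by
  ext n
  rw [map_finsuppSum, Finsupp.sum, Finsupp.finsetSum_apply]
  simp only [coeffs_param_pow_smul_map]
  rw [Finset.sum_ite_eq']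
  simp +contextual [eq_comm]

theorem coeffs_map_polyMap (f : X ⟶ Y) (x : N.obj X.poly) (n : ℕ) :
    N.coeffs (N.map (polyMap f) x) n = N.map f (N.coeffs x n) := by
  rw [polyMap, map_evalAt]
  have : ((N.coeffs x).sum fun n y => Y.param ^ n • N.map (f ≫ Y.toPoly) y) =
      ((N.coeffs x).mapRange (N.map f) (map_zero _)).sum
        fun n y => Y.param ^ n • N.map Y.toPoly y := by
    rw [Finsupp.sum_mapRange_index fun n => by rw [map_zero, smul_zero]]
    simp only [N.map_comp]
  rw [this, coeffs_sum, Finsupp.mapRange_apply]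

end QCoh

/-! ### Taylor coefficients of polynomial laws -/

/-- A polynomial law `M ⇝ N` over the affine point `X`: a natural transformation between the
restrictions of `M` and `N` to the affine points under `X`. -/
@[ext]
structure LawOver (X : AffinePoint S) (M N : QCoh S) where
  app : ∀ {Y : AffinePoint S} (_ : X ⟶ Y), M.obj Y → N.obj Y
  naturality : ∀ {Y Z : AffinePoint S} (f : X ⟶ Y) (g : Y ⟶ Z) (z : M.obj Y),
    app (f ≫ g) (M.map g z) = N.map g (app f z)

namespace LawOver

variable {X X' Y Z : AffinePoint S} {M N : QCoh S}

theorem ext_app {ψ ψ' : LawOver X M N}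
    (h : ∀ (Y : AffinePoint S) (f : X ⟶ Y) (z : M.obj Y), ψ.app f z = ψ'.app f z) : ψ = ψ' :=
  LawOver.ext (funext fun Y => funext fun f => funext fun z => h Y f z)

instance : Add (LawOver X M N) where
  add ψ ψ' :=
    { app := fun f z => ψ.app f z + ψ'.app f z
      naturality := fun f g z => by rw [ψ.naturality, ψ'.naturality, map_add] }

instance : Zero (LawOver X M N) where
  zero :=
    { app := fun _ _ => 0
      naturality := fun _ g _ => (map_zero (N.map g)).symm }

instance : AddCommMonoid (LawOver X M N) where
  add_assoc _ _ _ := ext_app fun _ _ _ => add_assoc _ _ _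
  zero_add _ := ext_app fun _ _ _ => zero_add _
  add_zero _ := ext_app fun _ _ _ => add_zero _
  add_comm _ _ := ext_app fun _ _ _ => add_comm _ _
  nsmul := nsmulRec

instance : Module X.ring (LawOver X M N) where
  smul a ψ :=
    { app := fun f z => ringHom f a • ψ.app f z
      naturality := fun f g z => by rw [ψ.naturality, map_smulₛₗ, ringHom_comp] }
  one_smul ψ := ext_app fun Y f z =>
    (congrArg (· • ψ.app f z) (map_one (ringHom f))).trans (one_smul _ _)
  mul_smul a b ψ := ext_app fun Y f z =>
    (congrArg (· • ψ.app f z) (map_mul (ringHom f) a b)).trans (mul_smul _ _ _)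
  smul_zero _ := ext_app fun _ _ _ => smul_zero _
  smul_add _ _ _ := ext_app fun _ _ _ => smul_add _ _ _
  add_smul a b ψ := ext_app fun Y f z =>
    (congrArg (· • ψ.app f z) (map_add (ringHom f) a b)).trans (add_smul _ _ _)
  zero_smul ψ := ext_app fun Y f z =>
    (congrArg (· • ψ.app f z) (map_zero (ringHom f))).trans (zero_smul _ _)

/-- Evaluation of laws at a point, as an additive map. -/
def evalHom (f : X ⟶ Y) (z : M.obj Y) : LawOver X M N →+ N.obj Y where
  toFun ψ := ψ.app f z
  map_zero' := rfl
  map_add' _ _ := rfl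

theorem smul_app (a : X.ring) (ψ : LawOver X M N) (f : X ⟶ Y) (z : M.obj Y) :
    (a • ψ).app f z = ringHom f a • ψ.app f z := rfl

/-- The restriction of a law over `X` to a law over `X'`, along `X ⟶ X'`. -/
def restrict (h : X ⟶ X') (ψ : LawOver X M N) : LawOver X' M N where
  app f := ψ.app (h ≫ f)
  naturality f g z := by rw [← ψ.naturality, Category.assoc]

/-- The coefficients of `ψ (z + t m)`, as a polynomial in `t`. -/
def taylor (ψ : LawOver X M N) (m : M.obj X) (f : X ⟶ Y) (z : M.obj Y) : ℕ →₀ N.obj Y :=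
  N.coeffs (ψ.app (f ≫ Y.toPoly) (M.map Y.toPoly z + Y.param • M.map (f ≫ Y.toPoly) m))

/-- Taylor's formula. -/
theorem app_add_smul (ψ : LawOver X M N) (m : M.obj X) (f : X ⟶ Y) (g : Y ⟶ Z) (z : M.obj Y)
    (b : Z.ring) :
    ψ.app (f ≫ g) (M.map g z + b • M.map (f ≫ g) m) =
      (ψ.taylor m f z).sum fun n y => b ^ n • N.map g y := by
  have h := ψ.naturality (f ≫ Y.toPoly) (evalAt g b)
    (M.map Y.toPoly z + Y.param • M.map (f ≫ Y.toPoly) m)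
  rw [map_add, map_smulₛₗ, ringHom_evalAt_param, ← M.map_comp, ← M.map_comp, Category.assoc,
    toPoly_evalAt] at h
  rw [h, N.map_evalAt]
  rfl

theorem app_add_smul_id (ψ : LawOver X M N) (m : M.obj X) (f : X ⟶ Y) (z : M.obj Y)
    (b : Y.ring) :
    ψ.app f (z + b • M.map f m) = (ψ.taylor m f z).sum fun n y => b ^ n • y := by
  have h := ψ.app_add_smul m f (𝟙 Y) z b
  rw [Category.comp_id] at h
  simpa only [M.map_id, N.map_id] using h

theorem taylor_map (ψ : LawOver X M N) (m : M.obj X) (f : X ⟶ Y) (g : Y ⟶ Z) (z : M.obj Y)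
    (n : ℕ) : ψ.taylor m (f ≫ g) (M.map g z) n = N.map g (ψ.taylor m f z n) := by
  rw [taylor, taylor, ← N.coeffs_map_polyMap, ← ψ.naturality, map_add, map_smulₛₗ,
    ringHom_polyMap_param, ← M.map_comp, ← M.map_comp, ← M.map_comp, Category.assoc,
    Category.assoc, toPoly_polyMap]

variable (N) in
/-- The `n`-th divided power of the derivative in the direction `m`: the value of
`dpDeriv N n m ψ` at `z` is the coefficient of `tⁿ` in `ψ (z + t m)`. -/
def dpDeriv (n : ℕ) (m : M.obj X) : Module.End X.ring (LawOver X M N) where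
  toFun ψ :=
    { app := fun f z => ψ.taylor m f z n
      naturality := fun f g z => ψ.taylor_map m f g z n }
  map_add' ψ ψ' := ext_app fun Y f z => DFunLike.congr_fun (map_add N.coeffs
    (ψ.app (f ≫ Y.toPoly) (M.map Y.toPoly z + Y.param • M.map (f ≫ Y.toPoly) m))
    (ψ'.app (f ≫ Y.toPoly) (M.map Y.toPoly z + Y.param • M.map (f ≫ Y.toPoly) m))) n
  map_smul' a ψ := ext_app fun Y f z => N.coeffs_smul (ringHom f a)
    (ψ.app (f ≫ Y.toPoly) (M.map Y.toPoly z + Y.param • M.map (f ≫ Y.toPoly) m)) n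

theorem dpDeriv_app (n : ℕ) (m : M.obj X) (ψ : LawOver X M N) (f : X ⟶ Y) (z : M.obj Y) :
    (dpDeriv N n m ψ).app f z = ψ.taylor m f z n := rfl

theorem dpDeriv_zero (m : M.obj X) : dpDeriv N 0 m = 1 := by
  refine LinearMap.ext fun ψ => ext_app fun Y f z => ?_
  -- evaluation at `t = 0`
  have h := ψ.app_add_smul_id m f z 0
  rw [zero_smul, add_zero] at h
  rw [dpDeriv_app, Module.End.one_apply, h, Finsupp.sum, Finset.sum_eq_single 0]
  · rw [pow_zero, one_smul]
  · intro n _ hn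
    rw [zero_pow hn, zero_smul]
  · intro h0
    rw [Finsupp.notMem_support_iff.mp h0, smul_zero]

theorem dpDeriv_smul (n : ℕ) (a : X.ring) (m : M.obj X) :
    dpDeriv N n (a • m) = a ^ n • dpDeriv N n m := by
  refine LinearMap.ext fun ψ => ext_app fun Y f z => ?_
  rw [LinearMap.smul_apply, smul_app, dpDeriv_app, dpDeriv_app, taylor, map_smulₛₗ, smul_smul,
    app_add_smul, Finsupp.sum, map_sum, Finsupp.finsetSum_apply]
  have h : ∀ k, (Y.param * ringHom (f ≫ Y.toPoly) a) ^ k • N.map Y.toPoly (ψ.taylor m f z k) =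
      Y.param ^ k • N.map Y.toPoly (ringHom f a ^ k • ψ.taylor m f z k) := fun k => by
    rw [map_smulₛₗ, mul_pow, mul_smul, ringHom_comp, map_pow]
  simp only [h, N.coeffs_param_pow_smul_map]
  rw [Finset.sum_ite_eq', map_pow]
  split_ifs with hn
  · rfl
  · rw [Finsupp.notMem_support_iff.mp hn, smul_zero]

/-- Expand `ψ ((z + t m) + t m')` first in the direction `m'` and then in the direction `m`. -/
theorem dpDeriv_add (n : ℕ) (m m' : M.obj X) :
    dpDeriv N n (m + m') =
      ∑ k ∈ Finset.HasAntidiagonal.antidiagonal n, dpDeriv N k.1 m * dpDeriv N k.2 m' := by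
  refine LinearMap.ext fun ψ => ext_app fun Y f z => ?_
  set w : M.obj Y.poly := M.map Y.toPoly z + Y.param • M.map (f ≫ Y.toPoly) m with hw
  have hr : (∑ k ∈ Finset.HasAntidiagonal.antidiagonal n,
      (dpDeriv N k.1 m * dpDeriv N k.2 m' : Module.End X.ring (LawOver X M N))) ψ =
      ∑ k ∈ Finset.HasAntidiagonal.antidiagonal n, dpDeriv N k.1 m (dpDeriv N k.2 m' ψ) := by
    rw [LinearMap.sum_apply]
    rfl
  have he : (∑ k ∈ Finset.HasAntidiagonal.antidiagonal n,
      dpDeriv N k.1 m (dpDeriv N k.2 m' ψ)).app f z =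
      ∑ k ∈ Finset.HasAntidiagonal.antidiagonal n,
        N.coeffs (ψ.taylor m' (f ≫ Y.toPoly) w k.2) k.1 := map_sum (evalHom f z) _ _
  rw [hr, he, dpDeriv_app, taylor, map_add, smul_add, ← add_assoc, ← hw, app_add_smul_id,
    Finsupp.sum_of_support_subset (s := (ψ.taylor m' (f ≫ Y.toPoly) w).support ∪
      Finset.range (n + 1)) _ Finset.subset_union_left _ fun _ _ => smul_zero _,
    map_sum, Finsupp.finsetSum_apply]
  simp only [N.coeffs_param_pow_smul]
  rw [← Finset.sum_filter, ← Finset.Nat.sum_antidiagonal_swap,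
    Finset.Nat.sum_antidiagonal_eq_sum_range_succ_mk]
  refine Finset.sum_congr ?_ fun _ _ => rfl
  ext k
  simp only [Finset.mem_filter, Finset.mem_union, Finset.mem_range]
  omega

/-- Compare the coefficients of `sⁱ tʲ` in `ψ (z + (s + t) m)`. -/
theorem dpDeriv_mul (i j : ℕ) (m : M.obj X) :
    dpDeriv N i m * dpDeriv N j m = (i + j).choose i • dpDeriv N (i + j) m := by
  refine LinearMap.ext fun ψ => ext_app fun Y f z => ?_
  set w : M.obj Y.poly := M.map Y.toPoly z + Y.param • M.map (f ≫ Y.toPoly) m with hw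
  have hr : (((i + j).choose i • dpDeriv N (i + j) m : Module.End X.ring (LawOver X M N)) ψ).app f z
      = (i + j).choose i • ψ.taylor m f z (i + j) := by
    rw [LinearMap.smul_apply]
    exact map_nsmul (evalHom f z) _ _
  change N.coeffs (N.coeffs (ψ.app ((f ≫ Y.toPoly) ≫ Y.poly.toPoly) (M.map Y.poly.toPoly w +
    Y.poly.param • M.map ((f ≫ Y.toPoly) ≫ Y.poly.toPoly) m)) j) i = _
  rw [hr, hw, map_add, map_smulₛₗ, ← M.map_comp, ← M.map_comp, add_assoc, ← add_smul,
    Category.assoc, app_add_smul]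
  have h : ∀ (n : ℕ) (y : N.obj Y), N.coeffs (N.coeffs
      ((ringHom Y.poly.toPoly Y.param + Y.poly.param) ^ n • N.map (Y.toPoly ≫ Y.poly.toPoly) y) j) i =
      if n = i + j then (i + j).choose i • y else 0 := fun n y => by
    have h1 : Polynomial.coeff (R := Y.poly.ring)
        ((ringHom Y.poly.toPoly Y.param + Y.poly.param) ^ n) j =
        Y.param ^ (n - j) * (n.choose j : Y.poly.ring) := by
      rw [add_comm]
      exact Polynomial.coeff_X_add_C_pow _ _ _
    rw [N.map_comp, N.coeffs_smul_map, h1, mul_smul, Nat.cast_smul_eq_nsmul, ← map_nsmul,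
      N.coeffs_param_pow_smul_map]
    split_ifs with h2 h3 h3
    · rw [h3, ← Nat.choose_symm_add, add_comm]
    · rw [Nat.choose_eq_zero_of_lt (by omega), zero_smul]
    · omega
    · rfl
  rw [Finsupp.sum, map_sum, Finsupp.finsetSum_apply, map_sum, Finsupp.finsetSum_apply]
  simp only [h]
  rw [Finset.sum_ite_eq']
  split_ifs with hn
  · rfl
  · rw [Finsupp.notMem_support_iff.mp hn, smul_zero]

/-- Both sides are the coefficient of `sⁱ tʲ` in `ψ (z + s m + t m')`. -/
theorem dpDeriv_comm (i j : ℕ) (m m' : M.obj X) :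
    dpDeriv N i m * dpDeriv N j m' = dpDeriv N j m' * dpDeriv N i m := by
  refine LinearMap.ext fun ψ => ext_app fun Y f z => ?_
  set w : M.obj Y.poly := M.map Y.toPoly z + Y.param • M.map (f ≫ Y.toPoly) m with hw
  set w' : M.obj Y.poly := M.map Y.toPoly z + Y.param • M.map (f ≫ Y.toPoly) m' with hw'
  change N.coeffs (N.coeffs (ψ.app ((f ≫ Y.toPoly) ≫ Y.poly.toPoly) (M.map Y.poly.toPoly w +
    Y.poly.param • M.map ((f ≫ Y.toPoly) ≫ Y.poly.toPoly) m')) j) i =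
    N.coeffs (ψ.taylor m (f ≫ Y.toPoly) w' i) j
  -- `polyMap Y.toPoly` sends `t` to the second of the two variables
  have h1 : M.map Y.poly.toPoly w + Y.poly.param • M.map ((f ≫ Y.toPoly) ≫ Y.poly.toPoly) m' =
      M.map (polyMap Y.toPoly) w' + ringHom Y.poly.toPoly Y.param •
        M.map ((f ≫ Y.toPoly) ≫ polyMap Y.toPoly) m := by
    rw [hw, hw', map_add, map_add, map_smulₛₗ, map_smulₛₗ, ringHom_polyMap_param, ← M.map_comp,
      ← M.map_comp, ← M.map_comp, ← M.map_comp, Category.assoc, Category.assoc, toPoly_polyMap,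
      add_right_comm]
  have h2 : (f ≫ Y.toPoly) ≫ Y.poly.toPoly = (f ≫ Y.toPoly) ≫ polyMap Y.toPoly := by
    rw [Category.assoc, Category.assoc, toPoly_polyMap]
  rw [h1, h2, app_add_smul, Finsupp.sum, map_sum, Finsupp.finsetSum_apply]
  have h3 : ∀ (n : ℕ) (x : N.obj Y.poly), N.coeffs
      (ringHom Y.poly.toPoly Y.param ^ n • N.map (polyMap Y.toPoly) x) j =
      Y.param ^ n • N.map Y.toPoly (N.coeffs x j) := fun n x => by
    rw [← map_pow, N.coeffs_smul, N.coeffs_map_polyMap]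
  simp only [h3]
  rw [map_sum, Finsupp.finsetSum_apply]
  simp only [N.coeffs_param_pow_smul_map]
  rw [Finset.sum_ite_eq']
  split_ifs with hn
  · rfl
  · rw [Finsupp.notMem_support_iff.mp hn, map_zero, Finsupp.zero_apply]

end LawOver

/-! ### The action of divided powers on laws -/

namespace LawOver

variable {X Y : AffinePoint S} {M N : QCoh S}

variable (X M N) in
open scoped IsMulCommutative in
/-- The operators `dpDeriv N n m` commute and satisfy the defining relations of the divided power
algebra. -/
theorem exists_dpAction :
    ∃ D : DividedPowerAlgebra X.ring (M.obj X) →ₐ[X.ring] Module.End X.ring (LawOver X M N),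
      ∀ n m, D (DividedPowerAlgebra.dp X.ring n m) = dpDeriv N n m := by
  let s : Set (Module.End X.ring (LawOver X M N)) :=
    Set.range fun p : ℕ × M.obj X => dpDeriv N p.1 p.2
  have : IsMulCommutative (Algebra.adjoin X.ring s) := Algebra.isMulCommutative_adjoin X.ring (by
    rintro _ ⟨p, rfl⟩ _ ⟨q, rfl⟩
    exact dpDeriv_comm _ _ _ _)
  let g : ℕ × M.obj X → Algebra.adjoin X.ring s :=
    fun p => ⟨dpDeriv N p.1 p.2, Algebra.subset_adjoin ⟨p, rfl⟩⟩
  refine ⟨(Algebra.adjoin X.ring s).val.comp (DividedPowerAlgebra.lift' (f := g)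
    (fun m => Subtype.ext (dpDeriv_zero m)) (fun n a m => Subtype.ext (dpDeriv_smul n a m))
    (fun i j m => Subtype.ext (dpDeriv_mul i j m)) fun n m m' => Subtype.ext ?_), fun n m => ?_⟩
  · rw [AddSubmonoidClass.coe_finsetSum]
    exact dpDeriv_add n m m'
  · rw [AlgHom.comp_apply, DividedPowerAlgebra.lift'_apply_dp]
    rfl

variable (X M N) in
/-- The action of the divided power algebra on laws over `X`, in which the divided power `m^[n]`
acts as `dpDeriv N n m`: constant coefficient differential operators. -/
def dpAction :
    DividedPowerAlgebra X.ring (M.obj X) →ₐ[X.ring] Module.End X.ring (LawOver X M N) :=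
  (exists_dpAction X M N).choose

theorem dpAction_dp (n : ℕ) (m : M.obj X) :
    dpAction X M N (DividedPowerAlgebra.dp X.ring n m) = dpDeriv N n m :=
  (exists_dpAction X M N).choose_spec n m

theorem restrict_dpAction (h : X ⟶ Y) (γ : DividedPowerAlgebra X.ring (M.obj X))
    (ψ : LawOver X M N) :
    restrict h (dpAction X M N γ ψ) =
      dpAction Y M N (dividedPowerMap (ringHom h) (M.map h) γ) (restrict h ψ) := by
  induction γ using DividedPowerAlgebra.induction_on generalizing ψ with
  | C a =>
    rw [dividedPowerMap_algebraMap, AlgHom.commutes, AlgHom.commutes,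
      Module.algebraMap_end_apply, Module.algebraMap_end_apply]
    rfl
  | add x y hx hy =>
    rw [map_add, map_add, map_add, LinearMap.add_apply, LinearMap.add_apply, ← hx, ← hy]
    rfl
  | dp x n m hx =>
    have h' : restrict h (dpDeriv N n m ψ) = dpDeriv N n (M.map h m) (restrict h ψ) := by
      refine ext_app fun Z f z => ?_
      change N.coeffs (ψ.app ((h ≫ f) ≫ Z.toPoly) (M.map Z.toPoly z + Z.param •
        M.map ((h ≫ f) ≫ Z.toPoly) m)) n = N.coeffs (ψ.app (h ≫ f ≫ Z.toPoly)
        (M.map Z.toPoly z + Z.param • M.map (f ≫ Z.toPoly) (M.map h m))) n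
      rw [← M.map_comp, Category.assoc]
    rw [map_mul, map_mul, map_mul, dividedPowerMap_dp, dpAction_dp, dpAction_dp,
      Module.End.mul_apply, Module.End.mul_apply, hx, h']

end LawOver

/-! ### The linear morphism induced by a polynomial law -/

namespace Law

variable {M N : QCoh S}

/-- The restriction of a polynomial law to the affine points under `X`. -/
def toLawOver (ψ : Law M N) (X : AffinePoint S) : LawOver X M N where
  app {Y} _ := ψ.app Y
  naturality _ g z := ψ.naturality g z

/-- The linear morphism `Γ(M) ⟶ N` induced by a law `ψ : M ⇝ N`: a section `γ` of `Γ(M)` is sent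
to the value at `0` of the law obtained from `ψ` by applying the differential operator `γ`. -/
def gammaHom (ψ : Law M N) : M.gamma ⟶ N where
  app X :=
    { toFun := fun γ => (LawOver.dpAction X M N γ (ψ.toLawOver X)).app (𝟙 X) 0
      map_add' := fun γ γ' => congrArg (fun D => (D (ψ.toLawOver X)).app (𝟙 X) 0)
        (map_add (LawOver.dpAction X M N) γ γ')
      map_smul' := fun a γ => congrArg (fun D => (D (ψ.toLawOver X)).app (𝟙 X) 0)
        (map_smul (LawOver.dpAction X M N) a γ) }
  naturality {X Y} f γ := by
    have h := (LawOver.dpAction X M N γ (ψ.toLawOver X)).naturality (𝟙 X) f 0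
    rw [map_zero, Category.id_comp] at h
    refine Eq.trans ?_ h
    have h' := congrArg (fun φ => LawOver.app φ (𝟙 Y) 0)
      (LawOver.restrict_dpAction f γ (ψ.toLawOver X))
    refine h'.symm.trans ?_
    change (LawOver.dpAction X M N γ (ψ.toLawOver X)).app (f ≫ 𝟙 Y) 0 = _
    rw [Category.comp_id]

/-- The homogeneous component of degree `n` of a law `ψ`: its value at `z` is the coefficient of
`tⁿ` in `ψ (t z)`. -/
def component (ψ : Law M N) (n : ℕ) : Law M N where
  app X z := N.coeffs (ψ.app X.poly (X.param • M.map X.toPoly z)) n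
  naturality {X Y} f z := by
    rw [← N.coeffs_map_polyMap, ← ψ.naturality, map_smulₛₗ, ringHom_polyMap_param, ← M.map_comp,
      ← M.map_comp, toPoly_polyMap]

theorem component_app (ψ : Law M N) (n : ℕ) (X : AffinePoint S) (z : M.obj X) :
    (ψ.component n).app X z = N.coeffs (ψ.app X.poly (X.param • M.map X.toPoly z)) n := rfl

theorem component_app_eq_dpDeriv (ψ : Law M N) (n : ℕ) (X : AffinePoint S) (z : M.obj X) :
    (ψ.component n).app X z = (LawOver.dpDeriv N n z (ψ.toLawOver X)).app (𝟙 X) 0 := by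
  change _ = N.coeffs (ψ.app X.poly (M.map X.toPoly 0 + X.param • M.map (𝟙 X ≫ X.toPoly) z)) n
  rw [map_zero, zero_add, Category.id_comp]
  rfl

theorem gammaHom_dp (ψ : Law M N) (n : ℕ) (X : AffinePoint S) (z : M.obj X) :
    ψ.gammaHom.app X (DividedPowerAlgebra.dp X.ring n z) = (ψ.component n).app X z := by
  rw [component_app_eq_dpDeriv, ← LawOver.dpAction_dp]
  rfl

theorem component_isHomogeneous (ψ : Law M N) (n : ℕ) : (ψ.component n).IsHomogeneous n := by
  intro X a z
  rw [component_app_eq_dpDeriv, component_app_eq_dpDeriv, LawOver.dpDeriv_smul,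
    LinearMap.smul_apply, LawOver.smul_app, ringHom_id]

theorem isSum_component (ψ : Law M N) : ψ.IsSum ψ.component := by
  intro X z
  set c := N.coeffs (ψ.app X.poly (X.param • M.map X.toPoly z)) with hc
  have hs : (Function.support fun n => (ψ.component n).app X z) ⊆ c.support := by
    intro n hn
    rw [Finset.mem_coe, Finsupp.mem_support_iff]
    exact hn
  refine ⟨c.support.finite_toSet.subset hs, ?_⟩
  rw [finsum_eq_sum_of_support_subset _ hs]
  -- evaluation at `t = 1`
  have h := ψ.naturality (evalAt (𝟙 X) 1) (X.param • M.map X.toPoly z)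
  rw [N.map_evalAt, map_smulₛₗ, ringHom_evalAt_param, one_smul, ← M.map_comp, toPoly_evalAt,
    M.map_id] at h
  rw [h]
  refine Finset.sum_congr rfl fun n _ => ?_
  change (1 : X.ring) ^ n • N.map (𝟙 X) (c n) = c n
  rw [one_pow, one_smul, N.map_id]

theorem induces_gammaHom (ψ : Law M N) : ψ.Induces ψ.gammaHom :=
  ⟨ψ.component, ψ.component_isHomogeneous, ψ.isSum_component, fun n X z => ψ.gammaHom_dp n X z⟩

/-- The decomposition of a law into homogeneous components is unique: if `ψ = ∑ ψₙ`, then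
`ψ (t z) = ∑ tⁿ ψₙ z`. -/
theorem IsSum.eq_component {ψ : Law M N} {ψs : ℕ → Law M N} (hψ : ψ.IsSum ψs)
    (h : ∀ n, (ψs n).IsHomogeneous n) (n : ℕ) : ψs n = ψ.component n := by
  refine Law.ext (funext fun X => funext fun z => ?_)
  obtain ⟨hf, hs⟩ := hψ X.poly (X.param • M.map X.toPoly z)
  have hk : ∀ k, N.coeffs ((ψs k).app X.poly (X.param • M.map X.toPoly z)) n =
      if k = n then (ψs k).app X z else 0 := fun k => by
    rw [h k, (ψs k).naturality, N.coeffs_param_pow_smul_map]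
  rw [component_app, hs, AddMonoidHom.map_finsum _ hf]
  have h2 := AddMonoidHom.map_finsum (Finsupp.applyAddHom (M := N.obj X) n)
    (f := fun k => N.coeffs ((ψs k).app X.poly (X.param • M.map X.toPoly z)))
    (hf.subset fun k hk h0 => hk ((congrArg N.coeffs h0).trans (map_zero _)))
  refine Eq.trans ?_ h2.symm
  rw [finsum_eq_single _ n fun k hkn => by
    rw [Finsupp.applyAddHom_apply, hk, if_neg hkn]]
  rw [Finsupp.applyAddHom_apply, hk, if_pos rfl]

theorem Induces.app_dp {ψ : Law M N} {α : M.gamma ⟶ N} (h : ψ.Induces α) (n : ℕ)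
    (X : AffinePoint S) (z : M.obj X) :
    α.app X (DividedPowerAlgebra.dp X.ring n z) = (ψ.component n).app X z := by
  obtain ⟨ψs, h₁, h₂, h₃⟩ := h
  rw [h₃, h₂.eq_component h₁]

end Law

/-- A linear morphism out of `Γ(M)` is determined by its values on the divided powers of sections:
the products of divided powers are found among the coefficients of `(z + t y)^[n]`. -/
theorem QCoh.gamma_hom_ext {M N : QCoh S} {α α' : M.gamma ⟶ N}
    (h : ∀ (n : ℕ) (X : AffinePoint S) (z : M.obj X),
      α.app X (DividedPowerAlgebra.dp X.ring n z : DividedPowerAlgebra X.ring (M.obj X)) =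
        α'.app X (DividedPowerAlgebra.dp X.ring n z : DividedPowerAlgebra X.ring (M.obj X))) :
    α = α' := by
  -- products of divided powers, which span `Γ(M)`
  let dps (X : AffinePoint S) (l : List (ℕ × M.obj X)) : DividedPowerAlgebra X.ring (M.obj X) :=
    (l.map fun p => DividedPowerAlgebra.dp X.ring p.1 p.2).prod
  -- induction on the number of factors
  have key : ∀ (k : ℕ) (X : AffinePoint S) (l : List (ℕ × M.obj X)), l.length = k →
      ∀ (n : ℕ) (z : M.obj X), α.app X (DividedPowerAlgebra.dp X.ring n z * dps X l :
        DividedPowerAlgebra X.ring (M.obj X)) =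
      α'.app X (DividedPowerAlgebra.dp X.ring n z * dps X l :
        DividedPowerAlgebra X.ring (M.obj X)) := by
    intro k
    induction k with
    | zero =>
      intro X l hl n z
      rw [List.length_eq_zero_iff.mp hl]
      change α.app X (_ * 1 : DividedPowerAlgebra X.ring (M.obj X)) =
        α'.app X (_ * 1 : DividedPowerAlgebra X.ring (M.obj X))
      rw [mul_one]
      exact h n X z
    | succ k ih =>
      rintro X (_ | ⟨⟨j, y⟩, l⟩) hl n z
      · cases hl
      have hl' : l.length = k := Nat.succ.inj hl
      let l' : List (ℕ × M.obj X.poly) := l.map fun p => (p.1, M.map X.toPoly p.2)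
      have hdps : dividedPowerMap (ringHom X.toPoly) (M.map X.toPoly) (dps X l) = dps X.poly l' := by
        simp only [dps, l', map_list_prod, List.map_map]
        congr 1
        refine List.map_congr_left fun p _ => ?_
        exact dividedPowerMap_dp _ _ _ _
      -- the coefficient of `t ^ j` in `γ ((z + t y)^[n + j] dps l)`, for `γ = α, α'`
      have hc : ∀ γ : M.gamma ⟶ N, N.coeffs (γ.app X.poly (DividedPowerAlgebra.dp X.poly.ring (n + j)
          (M.map X.toPoly z + X.param • M.map X.toPoly y) * dps X.poly l' :
            DividedPowerAlgebra X.poly.ring (M.obj X.poly))) j =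
          γ.app X (DividedPowerAlgebra.dp X.ring n z * dps X ((j, y) :: l) :
            DividedPowerAlgebra X.ring (M.obj X)) := fun γ => by
        have e : (DividedPowerAlgebra.dp X.poly.ring (n + j)
            (M.map X.toPoly z + X.param • M.map X.toPoly y) * dps X.poly l' :
              DividedPowerAlgebra X.poly.ring (M.obj X.poly)) =
            ∑ p ∈ Finset.HasAntidiagonal.antidiagonal (n + j), X.param ^ p.2 •
              (dividedPowerMap (ringHom X.toPoly) (M.map X.toPoly)
                (DividedPowerAlgebra.dp X.ring p.1 z * (DividedPowerAlgebra.dp X.ring p.2 y *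
                  dps X l))) := by
          rw [DividedPowerAlgebra.dp_add, Finset.sum_mul]
          refine Finset.sum_congr rfl fun p _ => ?_
          rw [map_mul, map_mul, hdps, dividedPowerMap_dp, dividedPowerMap_dp,
            DividedPowerAlgebra.dp_smul, mul_smul_comm, smul_mul_assoc, mul_assoc]
        have e' : γ.app X.poly (∑ p ∈ Finset.HasAntidiagonal.antidiagonal (n + j), X.param ^ p.2 •
              (dividedPowerMap (ringHom X.toPoly) (M.map X.toPoly)
                (DividedPowerAlgebra.dp X.ring p.1 z * (DividedPowerAlgebra.dp X.ring p.2 y *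
                  dps X l))) : DividedPowerAlgebra X.poly.ring (M.obj X.poly)) =
            ∑ p ∈ Finset.HasAntidiagonal.antidiagonal (n + j), X.param ^ p.2 •
              N.map X.toPoly (γ.app X
                (DividedPowerAlgebra.dp X.ring p.1 z * (DividedPowerAlgebra.dp X.ring p.2 y *
                  dps X l) : DividedPowerAlgebra X.ring (M.obj X))) := by
          refine (map_sum (γ.app X.poly) _ _).trans (Finset.sum_congr rfl fun p _ => ?_)
          exact ((γ.app X.poly).map_smul _ _).trans (congrArg _ (γ.naturality X.toPoly _))
        rw [e, e', map_sum, Finsupp.finsetSum_apply]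
        simp only [N.coeffs_param_pow_smul_map]
        rw [Finset.sum_eq_single (n, j)]
        · rw [if_pos rfl]
          rfl
        · rintro ⟨a, b⟩ hab hne
          rw [if_neg]
          rintro rfl
          obtain rfl : a = n :=
            Nat.add_right_cancel (Finset.HasAntidiagonal.mem_antidiagonal.mp hab)
          exact hne rfl
        · intro hn
          exact absurd (Finset.HasAntidiagonal.mem_antidiagonal (a := (n, j)).mpr rfl) hn
      rw [← hc α, ← hc α', ih X.poly l' (by simpa [l'] using hl')]
  refine QCoh.Hom.ext (funext fun X => LinearMap.ext fun x => ?_)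
  have key' : ∀ (x : DividedPowerAlgebra X.ring (M.obj X)) (l : List (ℕ × M.obj X)),
      α.app X (x * dps X l : DividedPowerAlgebra X.ring (M.obj X)) =
        α'.app X (x * dps X l : DividedPowerAlgebra X.ring (M.obj X)) := by
    intro x
    induction x using DividedPowerAlgebra.induction_on with
    | C a =>
      intro l
      have h0 := key _ X l rfl 0 0
      rw [DividedPowerAlgebra.dp_zero, one_mul] at h0
      rw [← Algebra.smul_def]
      exact ((α.app X).map_smul a _).trans ((congrArg _ h0).trans ((α'.app X).map_smul a _).symm)
    | add x y hx hy =>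
      intro l
      rw [add_mul]
      exact ((α.app X).map_add _ _).trans ((congrArg₂ _ (hx l) (hy l)).trans
        ((α'.app X).map_add _ _).symm)
    | dp x n m hx =>
      intro l
      rw [mul_assoc]
      exact hx ((n, m) :: l)
  have e : ∀ x : DividedPowerAlgebra X.ring (M.obj X), x * dps X [] = x := mul_one
  exact (congrArg (α.app X) (e x)).symm.trans ((key' x []).trans (congrArg (α'.app X) (e x)))

namespace Law

variable {M N : QCoh S}

theorem Induces.unique {ψ : Law M N} {α α' : M.gamma ⟶ N} (h : ψ.Induces α)
    (h' : ψ.Induces α') : α = α' :=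
  QCoh.gamma_hom_ext fun n X z => (h.app_dp n X z).trans (h'.app_dp n X z).symm

/-- Every polynomial law `M ⇝ N` induces a unique linear morphism `Γ(M) ⟶ N`. -/
theorem existsUnique_induces (ψ : Law M N) : ∃! α : M.gamma ⟶ N, ψ.Induces α :=
  ⟨ψ.gammaHom, ψ.induces_gammaHom, fun _ h => h.unique ψ.induces_gammaHom⟩

/-- A law is determined by the linear morphism that it induces. -/
theorem Induces.injective {ψ ψ' : Law M N} {α : M.gamma ⟶ N} (h : ψ.Induces α)
    (h' : ψ'.Induces α) : ψ = ψ' := by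
  refine Law.ext (funext fun X => funext fun z => ?_)
  rw [(ψ.isSum_component X z).2, (ψ'.isSum_component X z).2]
  refine finsum_congr fun n => ?_
  rw [← h.app_dp, ← h'.app_dp]

theorem Induces.comp_ofHom {P : QCoh S} {ψ : Law M N} {α : M.gamma ⟶ N} (h : ψ.Induces α)
    (φ : N ⟶ P) : (ψ.comp (ofHom φ)).Induces (α ≫ φ) := by
  obtain ⟨ψs, h₁, h₂, h₃⟩ := h
  refine ⟨fun n => (ψs n).comp (ofHom φ), fun n X a z => ?_, fun X z => ⟨?_, ?_⟩,
    fun n X z => congrArg (φ.app X) (h₃ n X z)⟩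
  · exact (congrArg (φ.app X) (h₁ n X a z)).trans ((φ.app X).map_smul _ _)
  · refine (h₂ X z).1.subset fun n hn h0 => hn ?_
    exact (congrArg (φ.app X) h0).trans (map_zero _)
  · exact (congrArg (φ.app X) (h₂ X z).2).trans
      ((φ.app X).toAddMonoidHom.map_finsum (h₂ X z).1)

end Law

/-! ### Colimits of sheaves of algebras -/

section Colimits

open LinearAlgebra

/-- Let `φ : R → R'` identify `R'` with the base change of `R` along `f`, and let `q : R' → Q` be
the universal quotient of `R'` in which the image under `φ` of a relation `r` on `R` holds. Then `Q` is
the base change of the quotient of `R` by `r`. -/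
theorem isBaseChangeAlong_ringQuot {A B : Type u} [CommRing A] [CommRing B] (f : A →+* B)
    {R R' Q : Type u} [Ring R] [Ring R'] [Ring Q] [Algebra A R] [Algebra B R'] [Algebra B Q]
    {φ : R →+* R'} {hφ : ∀ a, φ (algebraMap A R a) = algebraMap B R' (f a)}
    (h : IsBaseChangeAlong f (semilinearOfRingHom f φ hφ)) {r : R → R → Prop}
    (q : R' →ₐ[B] Q) (hq : Function.Surjective q)
    (hr : ∀ {C : Type u} [Ring C] [Algebra B C] (g : R' →ₐ[B] C),
      (∀ x y, r x y → g (φ x) = g (φ y)) → ∃ g' : Q →ₐ[B] C, ∀ x, g' (q x) = g x)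
    (k : RingQuot r →+* Q) (hk : ∀ a, k (algebraMap A _ a) = algebraMap B _ (f a))
    (hk' : ∀ x, k (RingQuot.mkAlgHom A r x) = q (φ x)) :
    IsBaseChangeAlong f (semilinearOfRingHom f k hk) := by
  let _ := f.toAlgebra
  let _ : Algebra A R' := Algebra.compHom _ f
  let _ : Algebra A Q := Algebra.compHom _ f
  have : IsScalarTower A B R' := ⟨fun a b n => mul_smul (f a) b n⟩
  have : IsScalarTower A B Q := ⟨fun a b n => mul_smul (f a) b n⟩
  let φ' : R →ₐ[A] R' := { φ with commutes' := hφ }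
  have h₀ : IsBaseChange B φ'.toLinearMap := h
  obtain ⟨j, hj⟩ := exists_algHom_of_isBaseChange h₀
    (Algebra.TensorProduct.includeRight.comp (RingQuot.mkAlgHom A r) :
      R →ₐ[A] B ⊗[A] RingQuot r)
  obtain ⟨j', hj'⟩ := hr j fun x y hxy =>
    (hj x).trans ((congrArg (fun z => (1 : B) ⊗ₜ[A] z) (RingQuot.mkAlgHom_rel A hxy)).trans
      (hj y).symm)
  let k' : RingQuot r →ₐ[A] Q := { k with commutes' := hk }
  refine isBaseChange_of_algHom k' j' (fun x => ?_) fun χ hχ => ?_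
  · obtain ⟨x, rfl⟩ := RingQuot.mkAlgHom_surjective A r x
    exact (congrArg j' (hk' x)).trans ((hj' _).trans (hj x))
  · have : χ.comp q = q := algHom_ext_of_isBaseChange h₀ fun x => by
      have h' := hχ (RingQuot.mkAlgHom A r x)
      change χ (k (RingQuot.mkAlgHom A r x)) = k (RingQuot.mkAlgHom A r x) at h'
      rw [hk'] at h'
      exact h'
    refine AlgHom.ext fun x => ?_
    obtain ⟨x, rfl⟩ := hq x
    exact DFunLike.congr_fun this x

namespace QCohAlg

theorem hom_ext {R R' : QCohAlg S} {φ φ' : R ⟶ R'} (h : ∀ X x, φ.app X x = φ'.app X x) :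
    φ = φ' :=
  QCohAlg.Hom.ext (funext fun X => AlgHom.ext fun x => h X x)

section Coequalizer

variable {R R' : QCohAlg S} (φ φ' : R ⟶ R')

/-- The relation `φ x = φ' x` imposed on the sections of `R'` by two morphisms `φ, φ' : R ⟶ R'`. -/
def coeqRel (X : AffinePoint S) (a b : R'.obj X) : Prop :=
  ∃ x : R.obj X, a = φ.app X x ∧ b = φ'.app X x

theorem exists_coeqMap {X Y : AffinePoint S} (f : X ⟶ Y) :
    ∃ k : RingQuot (coeqRel φ φ' X) →+* RingQuot (coeqRel φ φ' Y), ∀ x,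
      k (RingQuot.mkAlgHom X.ring _ x) = RingQuot.mkAlgHom Y.ring _ (R'.map f x) := by
  let g : R'.obj X →+* RingQuot (coeqRel φ φ' Y) :=
    (RingQuot.mkAlgHom Y.ring (coeqRel φ φ' Y)).toRingHom.comp (R'.map f)
  have hg : ∀ ⦃x y⦄, coeqRel φ φ' X x y → g x = g y := by
    rintro _ _ ⟨x, rfl, rfl⟩
    exact RingQuot.mkAlgHom_rel Y.ring
      ⟨R.map f x, (φ.naturality f x).symm, (φ'.naturality f x).symm⟩
  exact ⟨RingQuot.lift ⟨g, hg⟩, fun x =>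
    (congrArg _ (RingHom.congr_fun (RingQuot.mkAlgHom_coe X.ring _) x)).trans
      (RingQuot.lift_mkRingHom_apply g hg x)⟩

/-- The map induced on the quotients by a morphism of affine points. -/
def coeqMap {X Y : AffinePoint S} (f : X ⟶ Y) :
    RingQuot (coeqRel φ φ' X) →+* RingQuot (coeqRel φ φ' Y) := (exists_coeqMap φ φ' f).choose

theorem coeqMap_mk {X Y : AffinePoint S} (f : X ⟶ Y) (x : R'.obj X) :
    coeqMap φ φ' f (RingQuot.mkAlgHom X.ring _ x) = RingQuot.mkAlgHom Y.ring _ (R'.map f x) :=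
  (exists_coeqMap φ φ' f).choose_spec x

theorem coeqMap_algebraMap {X Y : AffinePoint S} (f : X ⟶ Y) (a : X.ring) :
    coeqMap φ φ' f (algebraMap X.ring _ a) = algebraMap Y.ring _ (ringHom f a) := by
  rw [← (RingQuot.mkAlgHom X.ring (coeqRel φ φ' X)).commutes, coeqMap_mk, R'.map_algebraMap,
    AlgHom.commutes]

/-- The coequalizer of two morphisms of sheaves of algebras, formed sectionwise. -/
def coeq : QCohAlg S where
  obj X := RingQuot (coeqRel φ φ' X)
  map f := coeqMap φ φ' f
  map_algebraMap f a := coeqMap_algebraMap φ φ' f a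
  map_id X m := by
    obtain ⟨x, rfl⟩ := RingQuot.mkAlgHom_surjective X.ring _ m
    rw [coeqMap_mk, R'.map_id]
  map_comp {X _ _} f g m := by
    obtain ⟨x, rfl⟩ := RingQuot.mkAlgHom_surjective X.ring _ m
    rw [coeqMap_mk, coeqMap_mk, coeqMap_mk, R'.map_comp]
  isBaseChange {X Y} f := by
    refine isBaseChangeAlong_ringQuot (ringHom f) (R'.isBaseChange f)
      (RingQuot.mkAlgHom Y.ring (coeqRel φ φ' Y)) (RingQuot.mkAlgHom_surjective Y.ring _)
      (fun {C} _ _ g hg => ?_) _ _ (coeqMap_mk φ φ' f)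
    -- the relations over `Y` are linear in `y`, so those coming from `X` imply all of them
    have : g.toLinearMap.comp (φ.app Y).toLinearMap = g.toLinearMap.comp (φ'.app Y).toLinearMap :=
      (R.isBaseChange f).hom_ext fun x => by
        change g (φ.app Y (R.map f x)) = g (φ'.app Y (R.map f x))
        rw [φ.naturality, φ'.naturality]
        exact hg _ _ ⟨x, rfl, rfl⟩
    refine ⟨RingQuot.liftAlgHom Y.ring ⟨g, ?_⟩, RingQuot.liftAlgHom_mkAlgHom_apply _ _ _⟩
    rintro _ _ ⟨y, rfl, rfl⟩
    exact LinearMap.congr_fun this y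

/-- The projection to the coequalizer. -/
def coeqπ : R' ⟶ coeq φ φ' where
  app X := RingQuot.mkAlgHom X.ring (coeqRel φ φ' X)
  naturality f x := (coeqMap_mk φ φ' f x).symm

theorem coeqπ_condition : φ ≫ coeqπ φ φ' = φ' ≫ coeqπ φ φ' :=
  hom_ext fun X x => RingQuot.mkAlgHom_rel X.ring ⟨x, rfl, rfl⟩

variable {φ φ'}

/-- The morphism out of the coequalizer given by a morphism that coequalizes. -/
def coeqDesc {C : QCohAlg S} (k : R' ⟶ C) (h : φ ≫ k = φ' ≫ k) : coeq φ φ' ⟶ C where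
  app X := RingQuot.liftAlgHom X.ring ⟨k.app X, by
    rintro _ _ ⟨x, rfl, rfl⟩
    exact congrArg (fun l : R ⟶ C => l.app X x) h⟩
  naturality {X Y} f m := by
    obtain ⟨x, rfl⟩ := RingQuot.mkAlgHom_surjective X.ring _ m
    have h1 := (coeqπ φ φ').naturality f x
    refine (congrArg _ h1.symm).trans ?_
    refine (RingQuot.liftAlgHom_mkAlgHom_apply _ _ _ _).trans ?_
    rw [k.naturality]
    exact congrArg _ (RingQuot.liftAlgHom_mkAlgHom_apply _ _ _ _).symm

variable (φ φ')

def coeqIsColimit : IsColimit (Cofork.ofπ (coeqπ φ φ') (coeqπ_condition φ φ')) :=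
  Cofork.IsColimit.mk _ (fun s => coeqDesc s.π s.condition)
    (fun s => hom_ext fun X x => RingQuot.liftAlgHom_mkAlgHom_apply _ _ _ x)
    fun s m hm => hom_ext fun X x => by
      obtain ⟨x, rfl⟩ := RingQuot.mkAlgHom_surjective X.ring _ x
      refine Eq.trans ?_ (RingQuot.liftAlgHom_mkAlgHom_apply _ _ _ x).symm
      exact congrArg (fun l : R' ⟶ s.pt => l.app X x) hm

end Coequalizer

instance : HasCoequalizers (QCohAlg S) :=
  have (R R' : QCohAlg S) (φ φ' : R ⟶ R') : HasColimit (parallelPair φ φ') :=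
    ⟨⟨⟨_, coeqIsColimit φ φ'⟩⟩⟩
  hasCoequalizers_of_hasColimit_parallelPair _

section FreeProduct

variable {I : Type} [DecidableEq I] (R : I → QCohAlg S)

variable {R} in
theorem inj_desc {C : QCohAlg S} (φ : ∀ i, R i ⟶ C) (i : I) : inj R i ≫ desc φ = φ i :=
  hom_ext fun X x => DFunLike.congr_fun (FreeProduct.lift_comp_ι X.ring (fun i => (R i).obj X)
    (fun {i} => (φ i).app X)) x

variable {R} in
theorem freeProduct_hom_ext {C : QCohAlg S} {g g' : freeProduct R ⟶ C}
    (h : ∀ i, inj R i ≫ g = inj R i ≫ g') : g = g' :=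
  hom_ext fun X => freeProduct_ringHom_ext (g := (g.app X).toRingHom) (g' := (g'.app X).toRingHom)
    (fun a => ((g.app X).commutes a).trans ((g'.app X).commutes a).symm)
    fun i r => congrArg (fun l : R i ⟶ C => l.app X r) (h i)

def freeProductIsColimit : IsColimit (Cofan.mk (freeProduct R) (inj R)) :=
  Cofan.IsColimit.mk _ (fun s => desc s.inj) (fun _ i => inj_desc _ i)
    fun _ _ hm => freeProduct_hom_ext fun i => (hm i).trans (inj_desc _ i).symm

end FreeProduct

instance : HasCoproducts.{0} (QCohAlg S) := by
  classical
  exact hasCoproducts_of_colimit_cofans (fun R => Cofan.mk (freeProduct R) (inj R))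
    fun R => freeProductIsColimit R

instance : HasColimitsOfSize.{0, 0} (QCohAlg S) := has_colimits_of_hasCoequalizers_and_coproducts

theorem tensorAlgebra_hom_ext {M : QCoh S} {C : QCohAlg S} {g g' : tensorAlgebra M ⟶ C}
    (h : ofModule M ≫ toHom g = ofModule M ≫ toHom g') : g = g' :=
  QCohAlg.Hom.ext (funext fun X => TensorAlgebra.hom_ext (LinearMap.ext fun m =>
    congrArg (fun l : M ⟶ C.toQCoh => l.app X m) h))

theorem ofModule_tensorLift {M : QCoh S} {C : QCohAlg S} (φ : M ⟶ C.toQCoh) :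
    ofModule M ≫ toHom (tensorLift φ) = φ :=
  QCoh.Hom.ext (funext fun X => LinearMap.ext fun m => TensorAlgebra.lift_ι_apply (φ.app X) m)

theorem toHom_comp {R R' R'' : QCohAlg S} (φ : R ⟶ R') (φ' : R' ⟶ R'') :
    toHom (φ ≫ φ') = toHom φ ≫ toHom φ' := rfl

/-- A square under a tensor algebra commutes if and only if it commutes on the generators. -/
theorem tensorLift_comp_eq_iff {M : QCoh S} {R R' C : QCohAlg S} {φ : M ⟶ R.toQCoh}
    {φ' : M ⟶ R'.toQCoh} {k : R ⟶ C} {k' : R' ⟶ C} :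
    tensorLift φ ≫ k = tensorLift φ' ≫ k' ↔ φ ≫ toHom k = φ' ≫ toHom k' := by
  constructor
  · intro h
    rw [← ofModule_tensorLift φ, ← ofModule_tensorLift φ', Category.assoc, Category.assoc,
      ← toHom_comp, ← toHom_comp, h]
  · intro h
    refine tensorAlgebra_hom_ext ?_
    rw [toHom_comp, toHom_comp, ← Category.assoc, ← Category.assoc, ofModule_tensorLift,
      ofModule_tensorLift, h]

end QCohAlg

end Colimits

/-! ### Cocones under the Clifford diagram -/

namespace WPoly

variable {d : ℕ} {Ψ : WPoly S d} {C : QCohAlg S}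

theorem injA_prodLeg (η : Ψ ⟶ (ofAlg S d).obj C) (i : Fin d) :
    Ψ.injA i ≫ prodLeg η = η.uA i :=
  QCohAlg.inj_desc (R := Ψ.factors) _ (some i)

theorem injT_prodLeg (η : Ψ ⟶ (ofAlg S d).obj C) :
    Ψ.injT ≫ prodLeg η = QCohAlg.tensorLift η.uneg1 :=
  QCohAlg.inj_desc (R := Ψ.factors) _ none

theorem freeProd_hom_ext {g g' : Ψ.freeProd ⟶ C} (hA : ∀ i, Ψ.injA i ≫ g = Ψ.injA i ≫ g')
    (hT : Ψ.injT ≫ g = Ψ.injT ≫ g') : g = g' :=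
  QCohAlg.freeProduct_hom_ext (R := Ψ.factors) fun
    | some i => hA i
    | none => hT

theorem commutatorHom_comp (φ : Ψ.G ⟶ C.toQCoh) :
    Ψ.commutatorHom ≫ QCohAlg.toHom (QCohAlg.tensorLift φ) =
      QCoh.tensorHom φ φ ≫ C.commutator := by
  refine QCoh.Hom.ext (funext fun X => TensorProduct.ext' fun (x y : Ψ.G.obj X) => ?_)
  let t : TensorAlgebra X.ring (Ψ.G.obj X) →ₐ[X.ring] C.obj X :=
    TensorAlgebra.lift X.ring (φ.app X)
  have ht : ∀ x, t (TensorAlgebra.ι X.ring x) = φ.app X x := TensorAlgebra.lift_ι_apply (φ.app X)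
  change t (TensorAlgebra.ι X.ring x * TensorAlgebra.ι X.ring y -
    TensorAlgebra.ι X.ring y * TensorAlgebra.ι X.ring x) =
      φ.app X x * φ.app X y - φ.app X y * φ.app X x
  rw [map_sub, map_mul, map_mul, ht, ht]

/-- For a morphism `p` from the free product to `C`, the law `(p ψ₋₁, p ψ₀, …, p ψ_{d-1})` from `F` to
`C ^ (d + 1)`. -/
def coordLaw (p : Ψ.freeProd ⟶ C) : Law Ψ.F (C.toQCoh.pow (d + 1)) where
  app X z := Fin.cons (p.app X (Ψ.injT.app X ((QCohAlg.ofModule Ψ.G).app X (Ψ.ψneg1.app X z))))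
    fun i => p.app X ((Ψ.injA i).app X ((Ψ.ψ i).app X z))
  naturality {X Y} f z := by
    funext j
    refine Fin.cases ?_ (fun i => ?_) j
    · exact ((((Ψ.ψneg1.comp (Law.ofHom (QCohAlg.ofModule Ψ.G))).comp
        (Law.ofAlgHom Ψ.injT)).comp (Law.ofAlgHom p))).naturality f z
    · exact (((Ψ.ψ i).comp (Law.ofAlgHom (Ψ.injA i))).comp (Law.ofAlgHom p)).naturality f z

theorem mixedLaw_comp (p : Ψ.freeProd ⟶ C) :
    Ψ.mixedLaw.comp (Law.ofAlgHom p) = (coordLaw p).comp ((ofAlg S d).obj C).ψlast := by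
  refine Law.ext (funext fun X => funext fun z => ?_)
  change p.app X (∑ i : Fin d, _ * _ ^ _) = ∑ i : Fin d, _ * _ ^ _
  rw [map_sum]
  refine Finset.sum_congr rfl fun i _ => ?_
  rw [map_mul, map_pow]
  rfl

/-- The law `u` of a morphism to `ofAlg C` is determined by its other components. -/
theorem Hom.u_eq_coordLaw (η : Ψ ⟶ (ofAlg S d).obj C) : Hom.u η = coordLaw (prodLeg η) := by
  refine Law.ext (funext fun X => funext fun z => funext fun j => ?_)
  refine Fin.cases ?_ (fun i => ?_) j
  · have h := congrArg (fun l => Law.app l X z) η.comm_neg1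
    refine h.symm.trans ?_
    have h' := congrArg (fun l : QCohAlg.tensorAlgebra Ψ.G ⟶ C =>
      l.app X ((QCohAlg.ofModule Ψ.G).app X (Ψ.ψneg1.app X z))) (injT_prodLeg η)
    exact (TensorAlgebra.lift_ι_apply (A := C.obj X) (η.uneg1.app X) _).symm.trans h'.symm
  · have h := congrArg (fun l => Law.app l X z) (η.comm i)
    refine h.symm.trans ?_
    exact (congrArg (fun l : Ψ.A i ⟶ C => l.app X ((Ψ.ψ i).app X z)) (injA_prodLeg η i)).symm

variable {α : Ψ.F.gamma ⟶ Ψ.Alast.toQCoh} {β : Ψ.F.gamma ⟶ Ψ.freeProd.toQCoh}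

/-- The square over `T(G ⊗ G)` expresses that a morphism respects `ψ₋₂`, the one over `T(Γ(F))` that it
respects `ψ_d`; for the latter, both composites with `Γ(F)` are induced by the same law. -/
theorem legs_condition (hα : Ψ.ψlast.Induces α) (hβ : Ψ.mixedLaw.Induces β)
    (η : Ψ ⟶ (ofAlg S d).obj C) (s : shape.L) :
    (Ψ.diagram α β).fst s ≫ legs α β η (shape.fst s) =
      (Ψ.diagram α β).snd s ≫ legs α β η (shape.snd s) := by
  let p : Ψ.freeProd ⟶ C := prodLeg η
  let q : Ψ.Alast ⟶ C := η.ulast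
  let r : Ψ.Aneg2 ⟶ C := η.uneg2
  let g : Ψ.G ⟶ C.toQCoh := η.uneg1
  have hg : Ψ.injT ≫ p = QCohAlg.tensorLift g := injT_prodLeg η
  rcases s with _ | _
  · change QCohAlg.tensorLift Ψ.ψneg2 ≫ r = (QCohAlg.tensorLift Ψ.commutatorHom ≫ Ψ.injT) ≫ p
    rw [Category.assoc, hg, QCohAlg.tensorLift_comp_eq_iff, commutatorHom_comp]
    exact η.comm_neg2
  · change QCohAlg.tensorLift α ≫ q = QCohAlg.tensorLift β ≫ p
    rw [QCohAlg.tensorLift_comp_eq_iff]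
    have e : Ψ.ψlast.comp (Law.ofAlgHom q) = Ψ.mixedLaw.comp (Law.ofAlgHom p) := by
      rw [mixedLaw_comp, ← Hom.u_eq_coordLaw]
      exact η.comm_last
    have h := hα.comp_ofHom (QCohAlg.toHom q)
    change (Ψ.ψlast.comp (Law.ofAlgHom q)).Induces _ at h
    rw [e] at h
    exact h.unique (hβ.comp_ofHom (QCohAlg.toHom p))

/-- Together with `exists_hom_of_legs`: morphisms from `Ψ` to the weighted polynomial law of `C` are
the same as cocones with vertex `C` over the Clifford diagram. -/
theorem hom_ext_of_legs {η η' : Ψ ⟶ (ofAlg S d).obj C}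
    (h : ∀ t, legs α β η t = legs α β η' t) : η = η' := by
  have hp : prodLeg η = prodLeg η' := h .prod
  refine Hom.ext ?_ (h .neg2) ?_ (funext fun i => ?_) (h .last)
  · rw [Hom.u_eq_coordLaw, Hom.u_eq_coordLaw, hp]
  · let g : Ψ.G ⟶ C.toQCoh := η.uneg1
    let g' : Ψ.G ⟶ C.toQCoh := η'.uneg1
    have h' : QCohAlg.tensorLift g = QCohAlg.tensorLift g' :=
      (injT_prodLeg η).symm.trans ((congrArg (Ψ.injT ≫ ·) hp).trans (injT_prodLeg η'))
    change g = g'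
    rw [← QCohAlg.ofModule_tensorLift g, h', QCohAlg.ofModule_tensorLift]
  · rw [← injA_prodLeg, ← injA_prodLeg, hp]

theorem exists_hom_of_legs (hα : Ψ.ψlast.Induces α) (hβ : Ψ.mixedLaw.Induces β)
    (k : ∀ t, (Ψ.diagram α β).right t ⟶ C)
    (w : ∀ s, (Ψ.diagram α β).fst s ≫ k (shape.fst s) =
      (Ψ.diagram α β).snd s ≫ k (shape.snd s)) :
    ∃ η : Ψ ⟶ (ofAlg S d).obj C, ∀ t, legs α β η t = k t := by
  let p : Ψ.freeProd ⟶ C := k .prod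
  let q : Ψ.Alast ⟶ C := k .last
  let r : Ψ.Aneg2 ⟶ C := k .neg2
  let g : Ψ.G ⟶ C.toQCoh := QCohAlg.ofModule Ψ.G ≫ QCohAlg.toHom (Ψ.injT ≫ p)
  have hg : QCohAlg.tensorLift g = Ψ.injT ≫ p :=
    QCohAlg.tensorAlgebra_hom_ext (QCohAlg.ofModule_tensorLift g)
  have h₁ : QCohAlg.tensorLift Ψ.ψneg2 ≫ r = (QCohAlg.tensorLift Ψ.commutatorHom ≫ Ψ.injT) ≫ p :=
    w .tensor
  have h₂ : QCohAlg.tensorLift α ≫ q = QCohAlg.tensorLift β ≫ p := w .gamma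
  rw [Category.assoc, QCohAlg.tensorLift_comp_eq_iff, ← hg, commutatorHom_comp] at h₁
  rw [QCohAlg.tensorLift_comp_eq_iff] at h₂
  have h₃ : Ψ.ψlast.comp (Law.ofAlgHom q) = Ψ.mixedLaw.comp (Law.ofAlgHom p) :=
    (hα.comp_ofHom (QCohAlg.toHom q)).injective (h₂ ▸ hβ.comp_ofHom (QCohAlg.toHom p))
  let η : Ψ ⟶ (ofAlg S d).obj C :=
    { u := coordLaw p
      uneg2 := r
      uneg1 := g
      uA := fun i => Ψ.injA i ≫ p
      ulast := q
      comm_neg2 := h₁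
      comm_neg1 := rfl
      comm := fun i => rfl
      comm_last := h₃.trans (mixedLaw_comp p) }
  refine ⟨η, ?_⟩
  rintro (_ | _ | _)
  · rfl
  · exact freeProd_hom_ext (fun i => injA_prodLeg η i) ((injT_prodLeg η).trans hg)
  · rfl

theorem legs_comp {C' : QCohAlg S} (η : Ψ ⟶ (ofAlg S d).obj C) (φ : C ⟶ C') (t : shape.R) :
    legs α β (η ≫ (ofAlg S d).map φ) t = legs α β η t ≫ φ := by
  rcases t with _ | _ | _
  · rfl
  · refine freeProd_hom_ext (fun i => ?_) ?_
    · refine (injA_prodLeg _ i).trans ?_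
      exact (congrArg (· ≫ φ) (injA_prodLeg η i)).symm
    · refine (injT_prodLeg _).trans (Eq.trans ?_ (congrArg (· ≫ φ) (injT_prodLeg η)).symm)
      refine QCohAlg.tensorAlgebra_hom_ext ?_
      let g : Ψ.G ⟶ C.toQCoh := η.uneg1
      exact (QCohAlg.ofModule_tensorLift (C := C') (g ≫ QCohAlg.toHom φ)).trans
        (congrArg (· ≫ QCohAlg.toHom φ) (QCohAlg.ofModule_tensorLift g)).symm
  · rfl

/-- The multicoequalizer of the Clifford diagram carries a universal morphism from `Ψ`. -/
theorem hasInitial_structuredArrow (Ψ : WPoly S d) :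
    HasInitial (StructuredArrow Ψ (ofAlg S d)) := by
  have hα := Ψ.ψlast.induces_gammaHom
  have hβ := Ψ.mixedLaw.induces_gammaHom
  let D := Ψ.diagram Ψ.ψlast.gammaHom Ψ.mixedLaw.gammaHom
  obtain ⟨η, hη⟩ := exists_hom_of_legs hα hβ (Multicoequalizer.π D) (Multicoequalizer.condition D)
  refine IsInitial.hasInitial (X := StructuredArrow.mk η) (IsInitial.ofUniqueHom
    (fun s => StructuredArrow.homMk (Multicoequalizer.desc D s.right (legs _ _ s.hom)
      (legs_condition hα hβ s.hom)) ?_) fun s m => ?_)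
  · refine hom_ext_of_legs (α := Ψ.ψlast.gammaHom) (β := Ψ.mixedLaw.gammaHom) fun t => ?_
    refine (legs_comp η _ t).trans ?_
    rw [hη]
    exact Multicoequalizer.π_desc D _ _ _ t
  · refine StructuredArrow.hom_ext _ _ (Multicoequalizer.hom_ext D _ _ fun t => ?_)
    refine Eq.trans ?_ (Multicoequalizer.π_desc D _ _ _ t).symm
    have h : η ≫ (ofAlg S d).map m.right = s.hom := StructuredArrow.w m
    rw [← h, legs_comp, hη]

/-- A universal morphism from `Ψ` to a weighted polynomial law `ofAlg C` exhibits `C` as the colimit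
of the Clifford diagram. -/
theorem nonempty_isColimit_of_universal (η : Ψ ⟶ (ofAlg S d).obj C)
    (hη : ∀ (E : QCohAlg S) (θ : Ψ ⟶ (ofAlg S d).obj E),
      ∃! φ : C ⟶ E, η ≫ (ofAlg S d).map φ = θ)
    (hα : Ψ.ψlast.Induces α) (hβ : Ψ.mixedLaw.Induces β) :
    Nonempty (IsColimit (Multicofork.ofπ (Ψ.diagram α β) C (legs α β η)
      (legs_condition hα hβ η))) := by
  choose θ hθ using fun E : Multicofork (Ψ.diagram α β) =>
    exists_hom_of_legs hα hβ E.π E.condition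
  choose φ hφ hφ' using fun E : Multicofork (Ψ.diagram α β) => hη E.pt (θ E)
  refine ⟨Multicofork.IsColimit.mk _ φ (fun E t => ?_) fun E m hm => hφ' E m ?_⟩
  · refine (legs_comp η (φ E) t).symm.trans ?_
    rw [hφ, hθ]
  · refine hom_ext_of_legs (α := α) (β := β) fun t => ?_
    rw [hθ]
    exact (legs_comp η m t).trans (hm t)

end WPoly

end

end PolyLaw

theorem mainTheorem1 (S : Scheme.{u}) (d : ℕ) :
    (WPoly.ofAlg S d).IsRightAdjoint ∧
      ∀ (Cl : WPoly S d ⥤ QCohAlg S) (adj : Cl ⊣ WPoly.ofAlg S d)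
        (Ψ : WPoly S d),
        (∃! α : Ψ.F.gamma ⟶ Ψ.Alast.toQCoh, Ψ.ψlast.Induces α) ∧
        (∃! β : Ψ.F.gamma ⟶ Ψ.freeProd.toQCoh, Ψ.mixedLaw.Induces β) ∧
        ∀ (α : Ψ.F.gamma ⟶ Ψ.Alast.toQCoh)
          (β : Ψ.F.gamma ⟶ Ψ.freeProd.toQCoh),
          Ψ.ψlast.Induces α → Ψ.mixedLaw.Induces β →
          ∃ w : ∀ s, (Ψ.diagram α β).fst s ≫
                WPoly.legs α β (adj.unit.app Ψ) (WPoly.shape.fst s) =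
              (Ψ.diagram α β).snd s ≫
                WPoly.legs α β (adj.unit.app Ψ) (WPoly.shape.snd s),
            Nonempty (IsColimit (Multicofork.ofπ (Ψ.diagram α β) (Cl.obj Ψ)
              (WPoly.legs α β (adj.unit.app Ψ)) w)) := by
  refine ⟨?_, fun Cl adj Ψ => ⟨Ψ.ψlast.existsUnique_induces, Ψ.mixedLaw.existsUnique_induces,
    fun α β hα hβ => ⟨WPoly.legs_condition hα hβ _, ?_⟩⟩⟩
  · have := WPoly.hasInitial_structuredArrow (S := S) (d := d)
    exact isRightAdjointOfStructuredArrowInitials _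
  · refine WPoly.nonempty_isColimit_of_universal _ (fun E θ => ?_) hα hβ
    refine ⟨(adj.homEquiv _ _).symm θ, ?_, fun φ hφ => ?_⟩
    · exact (adj.homEquiv_unit _ _ _).symm.trans (Equiv.apply_symm_apply _ _)
    · exact ((adj.homEquiv _ _).eq_symm_apply).mpr ((adj.homEquiv_unit _ _ _).trans hφ)
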